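/- For $\alpha\in\mathbb R$ let $$W_\alpha(x)=-\tfrac12\log(x_1^2+x_2^2)+\alpha\,\frac{x_1^2}{x_1^2+x_2^2}\quad (x=(x_1,x_2)\in\mathbb R^2\setminus\{0\}),\qquad W_\alpha(0)=+\infty ,$$ and for a Borel probability measure $\mu$ on $\mathbb R^2$ let $$I_\alpha(\mu)=\frac12\iint_{\mathbb R^2\times\mathbb R^2}\Big(W_\alpha(x-y)+\tfrac12\big(|x|^2+|y|^2\big)\Big)\,d\mu(x)\,d\mu(y).$$ For $\alpha\ge 0$ the integrand is nonnegative, so $I_\alpha(\mu)\in[0,+\infty]$ is well defined; if $\int|x|^2\,d\mu<\infty$ it equals $\frac12\iint W_\alpha(x-y)\,d\mu(x)\,d\mu(y)+\frac12\int|x|^2\,d\mu(x)$. **Theorem.** Let $0\le\alpha<1$, let $$\Omega_\alpha=\Big\{x\in\mathbb R^2:\ \frac{x_1^2}{1-\alpha}+\frac{x_2^2}{1+\alpha}<1\Big\},\qquad \mu_\alpha=\frac{1}{\pi\sqrt{1-\alpha^2}}\,\chi_{\Omega_\alpha}\,dx ,$$ and let $$C_\alpha=\frac12-\log\Big(\frac{\sqrt{1-\alpha}+\sqrt{1+\alpha}}2\Big)+\alpha\,\frac{\sqrt{1-\alpha}}{\sqrt{1-\alpha}+\sqrt{1+\alpha}}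 .$$ Then $\mu_\alpha$ is a probability measure and is the unique minimiser of $I_\alpha$ among all Borel probability measures on $\mathbb R^2$. Moreover the potential $(W_\alpha*\mu_\alpha)(x)=\int W_\alpha(x-y)\,d\mu_\alpha(y)$ is finite for every $x\in\mathbb R^2$ and satisfies the Euler–Lagrange conditions $$(W_\alpha*\mu_\alpha)(x)+\frac{|x|^2}2=C_\alpha\quad\text{for every }x\in\Omega_\alpha,\qquad (W_\alpha*\mu_\alpha)(x)+\frac{|x|^2}2\ge C_\alpha\quad\text{for every }x\in\mathbb R^2,$$ and $C_\alpha=2I_\alpha(\mu_\alpha)-\frac12\int_{\mathbb R^2}|x|^2\,d\mu_\alpha(x)$. -/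

import Mathlib

open MeasureTheory
open scoped ENNReal

noncomputable section

namespace EllipseLaw

/-- The plane `ℝ²` with its Euclidean norm; `x 0` and `x 1` are the coordinates `x₁`, `x₂`. -/
abbrev Plane : Type := EuclideanSpace ℝ (Fin 2)

/-- The integral of an extended-real function: integral of the positive part minus integral of the
negative part. (If both are infinite the value is `⊥`; this never happens to the integrals that
occur below.) -/
def extIntegral {X : Type*} [MeasurableSpace X] (μ : Measure X) (f : X → EReal) : EReal :=
  ((∫⁻ x, (f x).toENNReal ∂μ : ℝ≥0∞) : EReal) - ((∫⁻ x, (-f x).toENNReal ∂μ : ℝ≥0∞) : EReal)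

open Classical in
/-- The interaction potential
`W_α(x) = -(1/2) log (x₁² + x₂²) + α x₁² / (x₁² + x₂²)`, with `W_α(0) = +∞`. -/
def W (α : ℝ) (x : Plane) : EReal :=
  if x = 0 then ⊤
  else ((-(1 / 2) * Real.log (x 0 ^ 2 + x 1 ^ 2)
    + α * (x 0 ^ 2 / (x 0 ^ 2 + x 1 ^ 2)) : ℝ) : EReal)

/-- The convolution `(W_α ∗ μ)(x) = ∫ W_α(x - y) dμ(y)`. -/
def potential (α : ℝ) (μ : Measure Plane) (x : Plane) : EReal :=
  extIntegral μ fun y => W α (x - y)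

/-- The second moment `∫ |x|² dμ(x)`, possibly `+∞`. -/
def secondMoment (μ : Measure Plane) : EReal :=
  extIntegral μ fun x => ((‖x‖ ^ 2 : ℝ) : EReal)

/-- The energy
`I_α(μ) = (1/2) ∬ W_α(x - y) dμ(x) dμ(y) + (1/2) ∫ |x|² dμ(x)` of a probability measure,
where the two terms are put under one integral sign,
`I_α(μ) = (1/2) ∬ (W_α(x - y) + (|x|² + |y|²) / 2) dμ(x) dμ(y)`,
so that for `α ≥ 0` it makes sense in `[0, +∞]` for every probability measure: the integrand is
nonnegative by `neg_le_W`. If the second moment is finite, this is the sum of the two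
separate terms, by `energy_eq`. -/
def energy (α : ℝ) (μ : Measure Plane) : EReal :=
  ((1 / 2 : ℝ) : EReal) * extIntegral (μ.prod μ) fun p =>
    W α (p.1 - p.2) + (((‖p.1‖ ^ 2 + ‖p.2‖ ^ 2) / 2 : ℝ) : EReal)

/-- `μ` is a minimiser of `I_α` among the Borel probability measures on the plane. -/
def IsMinimiser (α : ℝ) (μ : Measure Plane) : Prop :=
  IsProbabilityMeasure μ ∧
    ∀ ν : Measure Plane, IsProbabilityMeasure ν → energy α μ ≤ energy α ν

/-- The domain enclosed by the ellipse with semi-axes `√(1 - α)` and `√(1 + α)`. -/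
def ellipse (α : ℝ) : Set Plane :=
  {x | x 0 ^ 2 / (1 - α) + x 1 ^ 2 / (1 + α) < 1}

/-- The normalised characteristic function of the ellipse, as a measure. -/
def ellipseLaw (α : ℝ) : Measure Plane :=
  ENNReal.ofReal (1 / (√(1 - α ^ 2) * Real.pi)) • (volume : Measure Plane).restrict (ellipse α)

/-- The constant of the Euler–Lagrange conditions. -/
def ellipseConst (α : ℝ) : ℝ :=
  1 / 2 - Real.log ((√(1 - α) + √(1 + α)) / 2) + α * (√(1 - α) / (√(1 - α) + √(1 + α)))

theorem measurable_W (α : ℝ) : Measurable (W α) := by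
  unfold W
  refine Measurable.ite (measurableSet_singleton 0) measurable_const ?_
  apply measurable_coe_real_ereal.comp
  fun_prop

/-- The lower bound that makes the energy well defined. -/
theorem neg_le_W {α : ℝ} (hα : 0 ≤ α) (x y : Plane) :
    ((-((‖x‖ ^ 2 + ‖y‖ ^ 2) / 2) : ℝ) : EReal) ≤ W α (x - y) := by
  unfold W
  split_ifs with h
  · exact le_top
  · rw [EReal.coe_le_coe_iff]
    set z := x - y with hz
    have hs : z 0 ^ 2 + z 1 ^ 2 = ‖z‖ ^ 2 := by
      rw [EuclideanSpace.norm_sq_eq]; simp [Fin.sum_univ_two]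
    have hzpos : 0 < ‖z‖ := norm_pos_iff.mpr h
    have h1 : 0 ≤ α * (z 0 ^ 2 / (z 0 ^ 2 + z 1 ^ 2)) := by positivity
    have h2 : ‖z‖ ≤ ‖x‖ + ‖y‖ := norm_sub_le x y
    have h3 : ‖z‖ ^ 2 ≤ 2 * (‖x‖ ^ 2 + ‖y‖ ^ 2) := by
      nlinarith [sq_nonneg (‖x‖ - ‖y‖), norm_nonneg x, norm_nonneg y]
    have h4 : Real.log (‖z‖ ^ 2) ≤ ‖z‖ ^ 2 / 2 := by
      have h5 := Real.log_le_sub_one_of_pos (show 0 < ‖z‖ ^ 2 / 2 by positivity)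
      rw [Real.log_div (by positivity) (by norm_num)] at h5
      have h6 := Real.log_le_sub_one_of_pos (show (0 : ℝ) < 2 by norm_num)
      linarith
    rw [hs] at h1 ⊢
    linarith

/-- For a probability measure with finite second moment the energy is the sum of the
interaction term and the confinement term. -/
theorem energy_eq {α : ℝ} (hα : 0 ≤ α) (μ : Measure Plane) [IsProbabilityMeasure μ]
    (hμ : secondMoment μ ≠ ⊤) :
    energy α μ = ((1 / 2 : ℝ) : EReal) * extIntegral (μ.prod μ) (fun p => W α (p.1 - p.2))
      + ((1 / 2 : ℝ) : EReal) * secondMoment μ := by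
  have hneg : ∀ r : ℝ, 0 ≤ r → (-(r : EReal)).toENNReal = 0 := fun r hr => by
    apply EReal.toENNReal_of_nonpos
    rw [← EReal.coe_neg]; exact_mod_cast neg_nonpos.mpr hr
  have hS : secondMoment μ = ((∫⁻ x, ENNReal.ofReal (‖x‖ ^ 2) ∂μ : ℝ≥0∞) : EReal) := by
    unfold secondMoment extIntegral
    have h0 : ∀ x : Plane, (-(((‖x‖ ^ 2 : ℝ)) : EReal)).toENNReal = 0 :=
      fun x => hneg _ (by positivity)
    simp only [h0, lintegral_zero, EReal.toENNReal_of_ne_top (EReal.coe_ne_top _),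
      EReal.toReal_coe]
    simp
  set S : ℝ≥0∞ := ∫⁻ x, ENNReal.ofReal (‖x‖ ^ 2) ∂μ with hSdef
  have hStop : S ≠ ⊤ := by rintro h; rw [hS, h] at hμ; simp at hμ
  let b : Plane × Plane → ℝ := fun p => (‖p.1‖ ^ 2 + ‖p.2‖ ^ 2) / 2
  have hb0 : ∀ p, 0 ≤ b p := fun p => by positivity
  have hbm : Measurable b := by fun_prop
  have hB : ∫⁻ p, ENNReal.ofReal (b p) ∂(μ.prod μ) = S := by
    have e : ∀ p, ENNReal.ofReal (b p) =
        ENNReal.ofReal (1 / 2) * (ENNReal.ofReal (‖p.1‖ ^ 2) + ENNReal.ofReal (‖p.2‖ ^ 2)) := by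
      intro p
      rw [← ENNReal.ofReal_add (by positivity) (by positivity),
        ← ENNReal.ofReal_mul (by norm_num)]
      congr 1; simp only [b]; ring
    simp only [e]
    rw [lintegral_const_mul _ (by fun_prop), lintegral_add_left (by fun_prop)]
    have e1 : ∫⁻ p : Plane × Plane, ENNReal.ofReal (‖p.1‖ ^ 2) ∂(μ.prod μ) = S := by
      rw [lintegral_prod _ (by fun_prop)]; simp [hSdef]
    have e2 : ∫⁻ p : Plane × Plane, ENNReal.ofReal (‖p.2‖ ^ 2) ∂(μ.prod μ) = S := by
      rw [lintegral_prod _ (by fun_prop)]; simp [hSdef]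
    rw [e1, e2, ← two_mul, ← mul_assoc, show (2 : ℝ≥0∞) = ENNReal.ofReal 2 by simp,
      ← ENNReal.ofReal_mul (by norm_num)]
    norm_num
  let w : Plane × Plane → EReal := fun p => W α (p.1 - p.2)
  have hwm : Measurable w := (measurable_W α).comp (measurable_fst.sub measurable_snd)
  have hwb : ∀ p, ((-(b p) : ℝ) : EReal) ≤ w p := fun p => neg_le_W hα p.1 p.2
  -- pointwise identities
  have hG0 : ∀ p, (-(w p + (b p : EReal))).toENNReal = 0 := by
    intro p
    apply EReal.toENNReal_of_nonpos
    have h := hwb p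
    induction hw : w p using EReal.rec with
    | bot => rw [hw] at h; simp at h
    | top => simp
    | coe r =>
      rw [hw] at h
      have h' : -(b p) ≤ r := by exact_mod_cast h
      rw [← EReal.coe_add, ← EReal.coe_neg]
      exact_mod_cast (by linarith : -(r + b p) ≤ 0)
  have hpt : ∀ p, (w p + (b p : EReal)).toENNReal + (-(w p)).toENNReal
      = (w p).toENNReal + ENNReal.ofReal (b p) := by
    intro p
    have h := hwb p
    induction hw : w p using EReal.rec with
    | bot => rw [hw] at h; simp at h
    | top => simp
    | coe r =>
      rw [hw] at h
      have h' : -(b p) ≤ r := by exact_mod_cast h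
      rw [← EReal.coe_add, ← EReal.coe_neg]
      simp only [EReal.toENNReal_of_ne_top (EReal.coe_ne_top _), EReal.toReal_coe]
      rcases le_total 0 r with hr | hr
      · rw [ENNReal.ofReal_of_nonpos (by linarith : -r ≤ 0), ENNReal.ofReal_add hr (hb0 p),
          add_zero]
      · rw [ENNReal.ofReal_of_nonpos hr, ← ENNReal.ofReal_add (by linarith) (by linarith)]
        ring_nf
  have hwle : ∀ p, (-(w p)).toENNReal ≤ ENNReal.ofReal (b p) := by
    intro p
    have h : -(w p) ≤ (b p : EReal) := by
      rw [EReal.neg_le]; simpa using hwb p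
    have := EReal.toENNReal_le_toENNReal h
    simpa [EReal.toENNReal_of_ne_top (EReal.coe_ne_top _)] using this
  have hNle : ∫⁻ p, (-(w p)).toENNReal ∂(μ.prod μ) ≤ S :=
    hB ▸ lintegral_mono hwle
  have hsum : ∫⁻ p, (w p + (b p : EReal)).toENNReal ∂(μ.prod μ)
      + ∫⁻ p, (-(w p)).toENNReal ∂(μ.prod μ)
      = ∫⁻ p, (w p).toENNReal ∂(μ.prod μ) + S := by
    have hNm : Measurable fun p => (-(w p)).toENNReal := hwm.neg.ereal_toENNReal
    rw [← hB, ← lintegral_add_right _ hNm,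
      ← lintegral_add_right _ hbm.ennreal_ofReal]
    exact lintegral_congr hpt
  have hE : energy α μ = ((1 / 2 : ℝ) : EReal) *
      ((∫⁻ p, (w p + (b p : EReal)).toENNReal ∂(μ.prod μ) : ℝ≥0∞) : EReal) := by
    change ((1 / 2 : ℝ) : EReal) * extIntegral (μ.prod μ) (fun p => w p + (b p : EReal)) = _
    unfold extIntegral
    simp only [hG0, lintegral_zero]
    simp
  rw [hE, hS]
  change _ = ((1 / 2 : ℝ) : EReal) * extIntegral (μ.prod μ) w + _
  unfold extIntegral
  generalize ∫⁻ p, (w p + (b p : EReal)).toENNReal ∂(μ.prod μ) = G at *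
  generalize ∫⁻ p, (w p).toENNReal ∂(μ.prod μ) = P at *
  generalize ∫⁻ p, (-(w p)).toENNReal ∂(μ.prod μ) = N at *
  have hN : N ≠ ⊤ := ne_top_of_le_ne_top hStop hNle
  clear_value S
  lift S to NNReal using hStop
  lift N to NNReal using hN
  by_cases hP : P = ⊤
  · subst hP
    have hG : G = ⊤ := by simpa using hsum
    subst hG
    have e1 : ((⊤ : ℝ≥0∞) : EReal) - ((N : ℝ≥0∞) : EReal) = ⊤ := by
      exact EReal.top_sub_coe (N : ℝ)
    rw [e1, EReal.coe_ennreal_top, EReal.coe_mul_top_of_pos (by norm_num)]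
    exact (EReal.top_add_coe (1 / 2 * (S : ℝ))).symm
  · lift P to NNReal using hP
    have hG : G ≠ ⊤ := by
      rintro rfl
      rw [top_add] at hsum
      exact (ENNReal.add_ne_top.mpr ⟨ENNReal.coe_ne_top, ENNReal.coe_ne_top⟩) hsum.symm
    lift G to NNReal using hG
    have h : (G : ℝ) + N = P + S := by exact_mod_cast hsum
    change ((1 / 2 : ℝ) : EReal) * ((G : ℝ) : EReal) = ((1 / 2 : ℝ) : EReal) *
      (((P : ℝ) : EReal) - ((N : ℝ) : EReal)) + ((1 / 2 : ℝ) : EReal) * ((S : ℝ) : EReal)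
    norm_cast
    have : (G : ℝ) = P - N + S := by linarith
    rw [this]; ring

end EllipseLaw

end

open EllipseLaw

/-!
# The ellipse law minimises the anisotropic logarithmic energy

Both halves of the argument rest on one identity, the decomposition of the interaction into
logarithmic plane waves (`realW_eq_integral`): for `x ≠ 0`,

`W_α(x) = α / 2 - log 2 - ∫_0^π w(φ) log |h_φ(x)| dφ`, `w(φ) = (1 + α cos 2φ) / π`,

where `h_φ(x) = x₂ cos φ - x₁ sin φ` is the coordinate of `x` along the unit vector
`(-sin φ, cos φ)`. For `0 ≤ α < 1` the weight `w` is positive.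

*Potential.* The projection of the ellipse law along `h_φ` is a semicircle law on `[-ℓ, ℓ]`, where
`ℓ² = 1 + α cos 2φ` (`map_height_ellipseLaw`). The logarithmic potential of the semicircle law
is explicit: it is `log 2 + 1 / 2 - log ℓ - s² / ℓ²` for `|s| ≤ ℓ`, and at least that much for all
`s` (`integral_log_sub_height_eq`, `integral_log_sub_height_le`). Now `w(φ) / ℓ² = 1 / π`, so
that after integration over `φ` the quadratic terms add up to exactly `|x|² / 2`. This gives the
Euler–Lagrange conditions, with equality on the ellipse because there `|h_φ(x)| ≤ ℓ` for every `φ`.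
The constant is evaluated by the mean value property of `log (1 + q z)`
(`integral_one_add_mul_cos_mul_log`).

*Uniqueness.* By Frullani's integral `-log |s| = ∫_0^∞ (exp (-t s²) - exp (-t)) / (2 t) dt`, so the
interaction is a superposition, with positive weights, of the kernels `exp (-t h_φ(x - y)²)` and of
constants, which do not see neutral charges. Gaussian kernels on the line are strictly positive
definite (`gaussEnergy_sub`), and a probability measure on the plane is determined by almost all
of its projections (`eq_of_ae_map_height_eq`). Hence the interaction energy of `ν - μ` is
nonnegative and vanishes only for `ν = μ` (`interaction_sub`). Together with the Euler–Lagrange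
conditions this bounds the energy of every measure from below by that of the ellipse law, with
equality only for the ellipse law itself (`energy_ellipseLaw_le`).
-/

namespace EllipseLaw

open Set Filter ProbabilityTheory
open scoped Real Topology ComplexConjugate

/-! ### Trigonometric moments of `log |sin|` -/

lemma hasDerivAt_sin_mul_log_sin {x : ℝ} (hx : Real.sin x ≠ 0) :
    HasDerivAt (fun x => Real.sin x * Real.log (Real.sin x))
      (Real.cos x * (Real.log (Real.sin x) + 1)) x := by
  have h := (Real.hasDerivAt_mul_log hx).comp x (Real.hasDerivAt_sin x)
  simpa [Function.comp_def, mul_comm] using h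

lemma continuous_sin_mul_log_sin :
    Continuous fun x : ℝ => Real.sin x * Real.log (Real.sin x) :=
  Real.continuous_mul_log.comp Real.continuous_sin

lemma intervalIntegrable_log_sin_mul {g : ℝ → ℝ} (hg : Continuous g) (a b : ℝ) :
    IntervalIntegrable (fun x => Real.log (Real.sin x) * g x) volume a b :=
  (intervalIntegrable_log_sin (a := a) (b := b)).mul_continuousOn hg.continuousOn

lemma intervalIntegrable_log_sin_sub_mul {g : ℝ → ℝ} (hg : Continuous g) (θ a b : ℝ) :
    IntervalIntegrable (fun x => Real.log (Real.sin (x - θ)) * g x) volume a b := by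
  have h := (intervalIntegrable_log_sin (a := a - θ) (b := b - θ)).comp_sub_right θ
  simp only [sub_add_cancel] at h
  exact h.mul_continuousOn hg.continuousOn

lemma integral_log_sin_mul_cos_two_mul :
    ∫ x in 0..π, Real.log (Real.sin x) * Real.cos (2 * x) = -(π / 2) := by
  have key := intervalIntegral.integral_eq_sub_of_hasDerivAt_of_le Real.pi_pos.le
    (f := fun x => Real.cos x * (Real.sin x * Real.log (Real.sin x))
      - (x / 2 + Real.sin x * Real.cos x / 2))
    (f' := fun x => Real.log (Real.sin x) * Real.cos (2 * x)) ?_ ?_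
    (intervalIntegrable_log_sin_mul (by fun_prop) 0 π)
  · rw [key]; simp
  · exact ((Real.continuous_cos.mul continuous_sin_mul_log_sin).sub (by fun_prop)).continuousOn
  · intro x hx
    have hs : Real.sin x ≠ 0 := (Real.sin_pos_of_mem_Ioo hx).ne'
    have h := ((Real.hasDerivAt_cos x).mul (hasDerivAt_sin_mul_log_sin hs)).sub
      (((hasDerivAt_id x).div_const 2).add
        (((Real.hasDerivAt_sin x).mul (Real.hasDerivAt_cos x)).div_const 2))
    refine h.congr_deriv ?_
    have h1 := Real.sin_sq_add_cos_sq x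
    rw [Real.cos_two_mul']
    linear_combination (1 / 2 : ℝ) * h1

lemma integral_log_sin_mul_cos_four_mul :
    ∫ x in 0..π, Real.log (Real.sin x) * Real.cos (4 * x) = -(π / 4) := by
  have key := intervalIntegral.integral_eq_sub_of_hasDerivAt_of_le Real.pi_pos.le
    (f := fun x => Real.cos x * Real.cos (2 * x) * (Real.sin x * Real.log (Real.sin x))
      - (x / 4 + Real.sin (2 * x) / 4 + Real.sin (4 * x) / 16))
    (f' := fun x => Real.log (Real.sin x) * Real.cos (4 * x)) ?_ ?_
    (intervalIntegrable_log_sin_mul (by fun_prop) 0 π)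
  · rw [key]
    have h4 : Real.sin (4 * π) = 0 := by simpa using Real.sin_nat_mul_pi 4
    simp [h4]
  · exact (((by fun_prop : Continuous fun x => Real.cos x * Real.cos (2 * x)).mul
      continuous_sin_mul_log_sin).sub (by fun_prop)).continuousOn
  · intro x hx
    have hs : Real.sin x ≠ 0 := (Real.sin_pos_of_mem_Ioo hx).ne'
    have hc2 : HasDerivAt (fun x => Real.cos (2 * x)) (-Real.sin (2 * x) * 2) x := by
      simpa using ((hasDerivAt_id x).const_mul 2).cos
    have hs2 : HasDerivAt (fun x => Real.sin (2 * x)) (Real.cos (2 * x) * 2) x := by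
      simpa using ((hasDerivAt_id x).const_mul 2).sin
    have hs4 : HasDerivAt (fun x => Real.sin (4 * x)) (Real.cos (4 * x) * 4) x := by
      simpa using ((hasDerivAt_id x).const_mul 4).sin
    have h := ((((Real.hasDerivAt_cos x).mul hc2)).mul (hasDerivAt_sin_mul_log_sin hs)).sub
      ((((hasDerivAt_id x).div_const 4).add (hs2.div_const 4)).add (hs4.div_const 16))
    refine h.congr_deriv ?_
    have h1 := Real.sin_sq_add_cos_sq x
    have e4 : Real.cos (4 * x) = 2 * (Real.cos x ^ 2 - Real.sin x ^ 2) ^ 2 - 1 := by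
      rw [show 4 * x = 2 * (2 * x) by ring, Real.cos_two_mul, Real.cos_two_mul']
    simp only [Pi.mul_apply]
    rw [e4, Real.cos_two_mul', Real.sin_two_mul]
    have e : Real.sin x ^ 2 = 1 - Real.cos x ^ 2 := by linarith
    generalize Real.log (Real.sin x) = l
    generalize Real.cos x = c at *
    generalize Real.sin x = s at *
    have e3 : s * s = 1 - c ^ 2 := by rw [← e]; ring
    rw [e]
    linear_combination (-(2 * c ^ 2 - 1) * l - 4 * c ^ 2 * l) * e3

lemma integral_log_sin_mul_sin (k : ℕ) :
    ∫ x in 0..π, Real.log (Real.sin x) * Real.sin (2 * k * x) = 0 := by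
  have h := intervalIntegral.integral_comp_sub_left (a := 0) (b := π)
    (fun x => Real.log (Real.sin x) * Real.sin (2 * k * x)) π
  have e : ∀ x, Real.log (Real.sin (π - x)) * Real.sin (2 * k * (π - x))
      = -(Real.log (Real.sin x) * Real.sin (2 * k * x)) := by
    intro x
    rw [Real.sin_pi_sub, show 2 * (k : ℝ) * (π - x) = -(2 * k * x) + k * (2 * π) by ring,
      Real.sin_add_nat_mul_two_pi, Real.sin_neg]
    ring
  simp only [e, sub_self, sub_zero, intervalIntegral.integral_neg] at h
  linarith

/-- `log |sin|` has period `π`, hence so has its product with a trigonometric polynomial in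
`2 x`. Recall that `Real.log` is even. -/
lemma periodic_log_sin : Function.Periodic (fun x => Real.log (Real.sin x)) π := by
  intro x
  simp only [Real.sin_add_pi, Real.log_neg_eq_log]

/-- The integrals of `log |sin (x - θ)|` against trigonometric polynomials, from its Fourier
coefficients. -/
lemma integral_log_sin_sub_mul (θ A B D : ℝ) :
    ∫ x in 0..π, Real.log (Real.sin (x - θ))
        * (A + B * Real.cos (2 * x) + D * Real.cos (4 * x))
      = -(π * Real.log 2) * A - π / 2 * (B * Real.cos (2 * θ))
        - π / 4 * (D * Real.cos (4 * θ)) := by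
  set f : ℝ → ℝ := fun x => Real.log (Real.sin x)
    * (A + B * Real.cos (2 * (x + θ)) + D * Real.cos (4 * (x + θ))) with hf
  have hper : Function.Periodic f π := by
    intro x
    have h0 := periodic_log_sin x
    simp only at h0
    simp only [hf, h0]
    rw [show 2 * (x + π + θ) = 2 * (x + θ) + 2 * π by ring,
      show 4 * (x + π + θ) = 4 * (x + θ) + 2 * π + 2 * π by ring]
    simp only [Real.cos_add_two_pi]
  have h1 : ∫ x in 0..π, Real.log (Real.sin (x - θ))
        * (A + B * Real.cos (2 * x) + D * Real.cos (4 * x)) = ∫ x in 0..π, f (x - θ) := by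
    simp only [hf, sub_add_cancel]
  have h2 := hper.intervalIntegral_add_eq (0 - θ) 0
  rw [h1, intervalIntegral.integral_comp_sub_right f θ, show π - θ = 0 - θ + π by ring, h2,
    zero_add]
  have e : f = fun x => Real.log (Real.sin x) * A
      + (B * Real.cos (2 * θ)) * (Real.log (Real.sin x) * Real.cos (2 * x))
      - (B * Real.sin (2 * θ)) * (Real.log (Real.sin x) * Real.sin (2 * (1 : ℕ) * x))
      + (D * Real.cos (4 * θ)) * (Real.log (Real.sin x) * Real.cos (4 * x))
      - (D * Real.sin (4 * θ)) * (Real.log (Real.sin x) * Real.sin (2 * (2 : ℕ) * x)) := by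
    funext x
    simp only [hf, mul_add, Real.cos_add]
    push_cast
    ring_nf
  have i (g : ℝ → ℝ) (hg : Continuous g) := intervalIntegrable_log_sin_mul hg 0 π
  have i1 := i (fun _ => A) (by fun_prop)
  have i2 := (i (fun x => Real.cos (2 * x)) (by fun_prop)).const_mul (B * Real.cos (2 * θ))
  have i3 := (i (fun x => Real.sin (2 * (1 : ℕ) * x)) (by fun_prop)).const_mul
    (B * Real.sin (2 * θ))
  have i4 := (i (fun x => Real.cos (4 * x)) (by fun_prop)).const_mul (D * Real.cos (4 * θ))
  have i5 := (i (fun x => Real.sin (2 * (2 : ℕ) * x)) (by fun_prop)).const_mul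
    (D * Real.sin (4 * θ))
  rw [e, intervalIntegral.integral_sub (((i1.add i2).sub i3).add i4) i5,
    intervalIntegral.integral_add ((i1.add i2).sub i3) i4,
    intervalIntegral.integral_sub (i1.add i2) i3,
    intervalIntegral.integral_add i1 i2]
  simp only [intervalIntegral.integral_const_mul, intervalIntegral.integral_mul_const,
    integral_log_sin_mul_sin, integral_log_sin_zero_pi, integral_log_sin_mul_cos_two_mul,
    integral_log_sin_mul_cos_four_mul]
  ring

/-! ### The logarithmic potential of the semicircle law -/

lemma intervalIntegrable_log_sub_cos (s a b : ℝ) :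
    IntervalIntegrable (fun ψ => Real.log (s - Real.cos ψ)) volume a b := by
  have h : AnalyticOnNhd ℝ (fun ψ => s - Real.cos ψ) univ :=
    analyticOnNhd_const.sub Real.analyticOnNhd_cos
  exact (h.mono (subset_univ _)).meromorphicOn.intervalIntegrable_log

lemma intervalIntegrable_log_sub_cos_mul (s : ℝ) {g : ℝ → ℝ} (hg : Continuous g) (a b : ℝ) :
    IntervalIntegrable (fun ψ => Real.log (s - Real.cos ψ) * g ψ) volume a b :=
  (intervalIntegrable_log_sub_cos s a b).mul_continuousOn hg.continuousOn

/-- The logarithmic potential of the semicircle law at the point `cos φ` of its support. Here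
`cos φ - cos ψ = -2 sin ((φ + ψ) / 2) sin ((φ - ψ) / 2)`, and the two factors contribute the two
halves of the integral of one function over a period. -/
lemma integral_log_cos_sub_cos (φ : ℝ) :
    ∫ ψ in 0..π, Real.log (Real.cos φ - Real.cos ψ) * Real.sin ψ ^ 2
      = π / 2 * (Real.cos φ ^ 2 - 1 / 2 - Real.log 2) := by
  set L : ℝ → ℝ := fun u => Real.log (Real.sin (u - -(φ / 2))) with hL
  set f : ℝ → ℝ := fun u => L u * (1 / 2 + 0 * Real.cos (2 * u) + (-1 / 2) * Real.cos (4 * u))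
    with hf
  have hsq : ∀ u, Real.sin (2 * u) ^ 2
      = 1 / 2 + 0 * Real.cos (2 * u) + (-1 / 2) * Real.cos (4 * u) := by
    intro u
    rw [Real.sin_sq_eq_half_sub, show 2 * (2 * u) = 4 * u by ring]; ring
  have hsq' : ∀ ψ, Real.sin ψ ^ 2
      = 1 / 2 + 0 * Real.cos (2 * (ψ / 2)) + (-1 / 2) * Real.cos (4 * (ψ / 2)) := by
    intro ψ
    rw [← hsq, show 2 * (ψ / 2) = ψ by ring]
  have hi : ∀ a b, IntervalIntegrable (fun ψ => f (ψ / 2)) volume a b := by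
    intro a b
    have h0 : IntervalIntegrable f volume (a / 2) (b / 2) :=
      intervalIntegrable_log_sin_sub_mul (by fun_prop) _ _ _
    have h := h0.comp_mul_right (c := 2⁻¹)
    simpa [div_eq_mul_inv] using h
  have hineg : IntervalIntegrable (fun ψ => f (-ψ / 2)) volume 0 π := by
    have := (IntervalIntegrable.iff_comp_neg (by simp)).mp (hi 0 (-π))
    simpa using this
  -- the logarithm of the product splits off the zero of `cos φ - cos ψ`
  have h1 : ∫ ψ in 0..π, Real.log (Real.cos φ - Real.cos ψ) * Real.sin ψ ^ 2
      = ∫ ψ in 0..π, (Real.log 2 * Real.sin ψ ^ 2 + f (ψ / 2) + f (-ψ / 2)) := by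
    refine intervalIntegral.integral_congr_ae ?_
    have hae : ∀ᵐ ψ : ℝ, ψ ≠ Real.arccos (Real.cos φ) := by
      simp [ae_iff]
    filter_upwards [hae] with ψ hne hψ
    rw [uIoc_of_le Real.pi_pos.le] at hψ
    have hcos : Real.cos φ - Real.cos ψ ≠ 0 := by
      intro h0
      apply hne
      rw [sub_eq_zero.mp h0, Real.arccos_cos hψ.1.le hψ.2]
    have hprod := Real.cos_sub_cos φ ψ
    rw [hprod] at hcos
    have ha : Real.sin ((φ + ψ) / 2) ≠ 0 := fun h => hcos (by rw [h]; ring)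
    have hb : Real.sin ((φ - ψ) / 2) ≠ 0 := fun h => hcos (by rw [h]; ring)
    rw [hprod, Real.log_mul (by simpa using ha) hb, Real.log_mul (by norm_num) ha,
      Real.log_neg_eq_log]
    simp only [hf, hL]
    rw [← hsq', ← hsq', neg_div, show ψ / 2 - -(φ / 2) = (φ + ψ) / 2 by ring,
      show -(ψ / 2) - -(φ / 2) = (φ - ψ) / 2 by ring, Real.sin_neg]
    ring
  have h2 : ∫ ψ in 0..π, f (-ψ / 2) = ∫ ψ in -π..0, f (ψ / 2) := by
    have := intervalIntegral.integral_comp_neg (a := 0) (b := π) (fun ψ => f (ψ / 2))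
    simpa using this
  have hper : Function.Periodic f π := by
    intro x
    have h0 := periodic_log_sin (x - -(φ / 2))
    simp only at h0
    simp only [hf, hL]
    rw [show x + π - -(φ / 2) = x - -(φ / 2) + π by ring, h0,
      show 2 * (x + π) = 2 * x + 2 * π by ring,
      show 4 * (x + π) = 4 * x + 2 * π + 2 * π by ring]
    simp only [Real.cos_add_two_pi]
  have h3 : (∫ ψ in -π..0, f (ψ / 2)) + ∫ ψ in 0..π, f (ψ / 2) = 2 * ∫ u in 0..π, f u := by
    rw [intervalIntegral.integral_add_adjacent_intervals (hi _ _) (hi _ _),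
      intervalIntegral.integral_comp_div f two_ne_zero]
    have := hper.intervalIntegral_add_eq (-π / 2) 0
    rw [show -π / 2 + π = π / 2 by ring, zero_add] at this
    rw [this, smul_eq_mul]
  rw [h1, intervalIntegral.integral_add (((Continuous.intervalIntegrable (by fun_prop) _ _)).add
      (hi _ _)) hineg, intervalIntegral.integral_add
      (Continuous.intervalIntegrable (by fun_prop) _ _) (hi _ _),
    intervalIntegral.integral_const_mul, integral_sin_sq, h2]
  have h4 := integral_log_sin_sub_mul (-(φ / 2)) (1 / 2) 0 (-1 / 2)
  rw [show ∫ u in 0..π, f u = _ from h4] at h3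
  rw [show 4 * -(φ / 2) = -(2 * φ) by ring, Real.cos_neg, Real.cos_two_mul φ] at h3
  simp only [Real.sin_zero, Real.cos_zero, Real.sin_pi, Real.cos_pi]
  linear_combination h3

lemma integral_log_sub_cos_of_abs_le {s : ℝ} (hs : |s| ≤ 1) :
    ∫ ψ in 0..π, Real.log (s - Real.cos ψ) * Real.sin ψ ^ 2
      = π / 2 * (s ^ 2 - 1 / 2 - Real.log 2) := by
  have h := abs_le.mp hs
  have := integral_log_cos_sub_cos (Real.arccos s)
  rwa [Real.cos_arccos h.1 h.2] at this

lemma integral_log_neg_sub_cos (s : ℝ) :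
    ∫ ψ in 0..π, Real.log (-s - Real.cos ψ) * Real.sin ψ ^ 2
      = ∫ ψ in 0..π, Real.log (s - Real.cos ψ) * Real.sin ψ ^ 2 := by
  have h := intervalIntegral.integral_comp_sub_left (a := 0) (b := π)
    (fun ψ => Real.log (s - Real.cos ψ) * Real.sin ψ ^ 2) π
  simp only [sub_self, sub_zero] at h
  rw [← h]
  congr 1
  funext ψ
  rw [Real.cos_pi_sub, Real.sin_pi_sub, ← Real.log_neg_eq_log (s - -Real.cos ψ)]
  ring_nf

/-- Outside its support the potential of the semicircle law is compared with its value at the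
endpoint, through the tangent line `log (s - t) ≤ log (1 - t) + (s - 1) / (1 - t)`. -/
lemma integral_log_sub_cos_bounds_of_one_le {s : ℝ} (hs : 1 ≤ s) :
    π / 2 * (1 / 2 - Real.log 2) ≤ ∫ ψ in 0..π, Real.log (s - Real.cos ψ) * Real.sin ψ ^ 2 ∧
    ∫ ψ in 0..π, Real.log (s - Real.cos ψ) * Real.sin ψ ^ 2
      ≤ π / 2 * (s ^ 2 - 1 / 2 - Real.log 2) := by
  have h1 := integral_log_sub_cos_of_abs_le (s := 1) (by simp)
  have hi := fun s => intervalIntegrable_log_sub_cos_mul s (g := fun ψ => Real.sin ψ ^ 2)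
    (by fun_prop) 0 π
  have hlt : ∀ ψ ∈ Ioo 0 π, Real.cos ψ < 1 := by
    intro ψ hψ
    rw [← Real.cos_zero]
    exact Real.cos_lt_cos_of_nonneg_of_le_pi le_rfl hψ.2.le hψ.1
  constructor
  · have : ∫ ψ in 0..π, Real.log (1 - Real.cos ψ) * Real.sin ψ ^ 2
        ≤ ∫ ψ in 0..π, Real.log (s - Real.cos ψ) * Real.sin ψ ^ 2 := by
      refine intervalIntegral.integral_mono_on_of_le_Ioo Real.pi_pos.le (hi 1) (hi s) ?_
      intro ψ hψ
      have := hlt ψ hψ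
      exact mul_le_mul_of_nonneg_right (Real.log_le_log (by linarith) (by linarith))
        (sq_nonneg _)
    rw [h1] at this
    linarith
  · have hm : ∫ ψ in 0..π, Real.log (s - Real.cos ψ) * Real.sin ψ ^ 2
        ≤ ∫ ψ in 0..π, (Real.log (1 - Real.cos ψ) * Real.sin ψ ^ 2
          + (s - 1) * (1 + Real.cos ψ)) := by
      refine intervalIntegral.integral_mono_on_of_le_Ioo Real.pi_pos.le (hi s)
        ((hi 1).add (Continuous.intervalIntegrable (by fun_prop) _ _)) ?_
      intro ψ hψ
      have hc : 0 < 1 - Real.cos ψ := by linarith [hlt ψ hψ]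
      have hlog : Real.log (s - Real.cos ψ)
          ≤ Real.log (1 - Real.cos ψ) + (s - 1) / (1 - Real.cos ψ) := by
        have h2 := Real.log_le_sub_one_of_pos
          (show 0 < (s - Real.cos ψ) / (1 - Real.cos ψ) from div_pos (by linarith) hc)
        rw [Real.log_div (by linarith) hc.ne'] at h2
        have h3 : (s - Real.cos ψ) / (1 - Real.cos ψ) - 1 = (s - 1) / (1 - Real.cos ψ) := by
          field_simp; ring
        linarith
      have h4 := mul_le_mul_of_nonneg_right hlog (sq_nonneg (Real.sin ψ))
      have h5 : (s - 1) / (1 - Real.cos ψ) * Real.sin ψ ^ 2 = (s - 1) * (1 + Real.cos ψ) := by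
        rw [Real.sin_sq]; field_simp; ring
      linarith
    rw [intervalIntegral.integral_add (hi 1) (Continuous.intervalIntegrable (by fun_prop) _ _),
      h1, intervalIntegral.integral_const_mul, intervalIntegral.integral_add (by simp)
      (Continuous.intervalIntegrable (by fun_prop) _ _)] at hm
    simp at hm
    nlinarith [Real.pi_pos, mul_nonneg Real.pi_pos.le (sq_nonneg (s - 1))]

lemma integral_log_sub_cos_le (s : ℝ) :
    ∫ ψ in 0..π, Real.log (s - Real.cos ψ) * Real.sin ψ ^ 2
      ≤ π / 2 * (s ^ 2 - 1 / 2 - Real.log 2) := by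
  rcases le_total |s| 1 with h | h
  · exact (integral_log_sub_cos_of_abs_le h).le
  · rcases le_abs.mp h with h | h
    · exact (integral_log_sub_cos_bounds_of_one_le h).2
    · have := (integral_log_sub_cos_bounds_of_one_le h).2
      rwa [integral_log_neg_sub_cos, neg_sq] at this

lemma le_integral_log_sub_cos (s : ℝ) :
    π / 2 * (-(1 / 2) - Real.log 2)
      ≤ ∫ ψ in 0..π, Real.log (s - Real.cos ψ) * Real.sin ψ ^ 2 := by
  have hp := Real.pi_pos
  rcases le_total |s| 1 with h | h
  · rw [integral_log_sub_cos_of_abs_le h]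
    nlinarith [mul_nonneg hp.le (sq_nonneg s)]
  · rcases le_abs.mp h with h | h
    · linarith [(integral_log_sub_cos_bounds_of_one_le h).1]
    · have := (integral_log_sub_cos_bounds_of_one_le h).1
      rw [integral_log_neg_sub_cos] at this
      linarith

/-! ### A logarithmic integral by the mean value property -/

/-- With `1 + α cos θ = |1 + q exp (i θ)|² / (1 + q²)` this is the mean value property on the unit
circle for the real part of `(1 + α (z + z⁻¹) / 2) log (1 + q z)`. -/
lemma integral_one_add_mul_cos_mul_log {q : ℝ} (hq0 : 0 ≤ q) (hq1 : q < 1) (α : ℝ)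
    (hα : α * (1 + q ^ 2) = 2 * q) :
    ∫ φ in 0..π, (1 + α * Real.cos (2 * φ)) * Real.log (1 + α * Real.cos (2 * φ))
      = π * (α * q - Real.log (1 + q ^ 2)) := by
  set l : ℂ → ℂ := fun z => Complex.log (1 + q * z) with hl
  set U : Set ℂ := {z | 0 < (1 + q * z).re} with hU
  have hUo : IsOpen U := isOpen_lt continuous_const (by fun_prop)
  have hUball : Metric.closedBall (0 : ℂ) 1 ⊆ U := by
    intro z hz
    have h1 : ‖z‖ ≤ 1 := by simpa using hz
    have h2 := (abs_le.mp ((Complex.abs_re_le_norm z).trans h1)).1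
    simp only [hU, mem_ofPred_eq, Complex.add_re, Complex.one_re, Complex.re_ofReal_mul]
    nlinarith
  have h0U : (0 : ℂ) ∈ U := by simp [hU]
  have hderiv : ∀ z ∈ U, HasDerivAt l (q / (1 + q * z)) z := by
    intro z hz
    have h : HasDerivAt (fun z : ℂ => 1 + q * z) q z := by
      simpa using ((hasDerivAt_id z).const_mul (q : ℂ)).const_add 1
    exact h.clog (Or.inl hz)
  have hld : DifferentiableOn ℂ l U := fun z hz =>
    (hderiv z hz).differentiableAt.differentiableWithinAt
  have hl0 : l 0 = 0 := by simp [hl]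
  have hds : DifferentiableOn ℂ (dslope l 0) U :=
    (Complex.differentiableOn_dslope (hUo.mem_nhds h0U)).mpr hld
  -- the mean value property turns the division by `z` into a derivative at the centre
  set F : ℂ → ℂ := fun z => (1 + α / 2 * z) * l z + α / 2 * dslope l 0 z with hF
  have hFd : DifferentiableOn ℂ F U :=
    (DifferentiableOn.mul (by fun_prop) hld).add (hds.const_mul _)
  have hF0 : F 0 = ((α * q / 2 : ℝ) : ℂ) := by
    simp only [hF, hl0, dslope_same, (hderiv 0 h0U).deriv]
    push_cast; simp; ring
  have hFcont : ContinuousOn F (Metric.closedBall 0 1) := hFd.continuousOn.mono hUball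
  have hmean : Real.circleAverage F 0 1 = ((α * q / 2 : ℝ) : ℂ) := by
    rw [← hF0]
    apply DiffContOnCl.circleAverage
    refine DifferentiableOn.diffContOnCl (hFd.mono ?_)
    rw [abs_one]
    exact Metric.closure_ball_subset_closedBall.trans hUball
  have hFint : CircleIntegrable F 0 1 := by
    apply ContinuousOn.circleIntegrable zero_le_one
    exact hFcont.mono Metric.sphere_subset_closedBall
  have hre := Complex.reCLM.circleAverage_comp_comm hFint
  rw [hmean] at hre
  have hq2 : 0 < 1 + q ^ 2 := by positivity
  have hval : ∀ θ : ℝ, 0 < 1 + α * Real.cos θ ∧ (F (circleMap 0 1 θ)).re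
      = (1 + α * Real.cos θ) * ((Real.log (1 + q ^ 2) + Real.log (1 + α * Real.cos θ)) / 2) := by
    intro θ
    set z := circleMap 0 1 θ with hz
    have hze : z = ⟨Real.cos θ, Real.sin θ⟩ := by
      apply Complex.ext <;> simp [hz, circleMap, Complex.exp_ofReal_mul_I_re,
        Complex.exp_ofReal_mul_I_im]
    have hzn : ‖z‖ = 1 := by simp [hz]
    have hz0 : z ≠ 0 := by rw [← norm_ne_zero_iff, hzn]; exact one_ne_zero
    have hzU : z ∈ U := hUball (by simp [hzn])
    have hne : (1 + q * z) ≠ 0 := by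
      intro h
      have h2 : 0 < (1 + q * z).re := hzU
      rw [h] at h2; simp at h2
    have hsq : ‖1 + q * z‖ ^ 2 = (1 + q ^ 2) * (1 + α * Real.cos θ) := by
      rw [← Complex.normSq_eq_norm_sq, Complex.normSq_apply, hze]
      simp
      linear_combination (-Real.cos θ) * hα + q ^ 2 * Real.sin_sq_add_cos_sq θ
    have hpos : 0 < 1 + α * Real.cos θ := by
      have : 0 < (1 + q ^ 2) * (1 + α * Real.cos θ) := by
        rw [← hsq]; exact pow_pos (norm_pos_iff.mpr hne) 2
      exact pos_of_mul_pos_right this hq2.le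
    refine ⟨hpos, ?_⟩
    have hFz : F z = ((1 + α * Real.cos θ : ℝ) : ℂ) * l z := by
      have hzi : z⁻¹ = ⟨Real.cos θ, -Real.sin θ⟩ := by
        rw [Complex.inv_def, Complex.normSq_eq_norm_sq, hzn, hze]
        apply Complex.ext <;> simp
      have hsum : z + z⁻¹ = 2 * ((Real.cos θ : ℝ) : ℂ) := by
        rw [hzi, hze]
        apply Complex.ext <;> simp [-Complex.ofReal_cos]; ring
      simp only [hF]
      rw [dslope_of_ne _ hz0, slope_def_field, hl0]
      push_cast at hsum ⊢
      rw [sub_zero, sub_zero, div_eq_mul_inv]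
      linear_combination (α / 2 * l z : ℂ) * hsum
    rw [hFz, Complex.re_ofReal_mul]
    congr 1
    simp only [hl]
    rw [Complex.log_re, ← Real.log_mul hq2.ne' hpos.ne', ← hsq, Real.log_pow]
    push_cast; ring
  have hcα : Continuous fun θ => 1 + α * Real.cos θ := by fun_prop
  have hlogc : Continuous fun θ => Real.log (1 + α * Real.cos θ) :=
    hcα.log fun θ => (hval θ).1.ne'
  rw [Real.circleAverage_def] at hre
  simp only [Function.comp_apply, Complex.reCLM_apply, (hval _).2, Complex.ofReal_re,
    smul_eq_mul] at hre
  have e : ∀ θ : ℝ, (1 + α * Real.cos θ)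
      * ((Real.log (1 + q ^ 2) + Real.log (1 + α * Real.cos θ)) / 2)
      = Real.log (1 + q ^ 2) / 2 * (1 + α * Real.cos θ)
        + 1 / 2 * ((1 + α * Real.cos θ) * Real.log (1 + α * Real.cos θ)) := fun θ => by ring
  simp only [e] at hre
  have i1 : IntervalIntegrable (fun θ => Real.log (1 + q ^ 2) / 2 * (1 + α * Real.cos θ))
      volume 0 (2 * π) := (continuous_const.mul hcα).intervalIntegrable _ _
  have i2 : IntervalIntegrable
      (fun θ => 1 / 2 * ((1 + α * Real.cos θ) * Real.log (1 + α * Real.cos θ)))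
      volume 0 (2 * π) := (continuous_const.mul (hcα.mul hlogc)).intervalIntegrable _ _
  rw [intervalIntegral.integral_add i1 i2,
    intervalIntegral.integral_const_mul, intervalIntegral.integral_const_mul,
    intervalIntegral.integral_add (by simp)
      (Continuous.intervalIntegrable (by fun_prop) _ _)] at hre
  simp only [intervalIntegral.integral_const, intervalIntegral.integral_const_mul, integral_cos,
    Real.sin_two_pi, Real.sin_zero] at hre
  rw [intervalIntegral.integral_comp_mul_left
    (fun θ => (1 + α * Real.cos θ) * Real.log (1 + α * Real.cos θ)) two_ne_zero, mul_zero,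
    smul_eq_mul]
  field_simp at hre
  simp only [smul_eq_mul] at hre
  linarith

/-! ### Frullani's integral for the logarithm -/

lemma integrableOn_exp_sub_exp_div {a b : ℝ} (ha : 0 < a) (hb : 0 < b) :
    IntegrableOn (fun t => t⁻¹ • (Real.exp (-(a * t)) - Real.exp (-(b * t)))) (Ioi 0) := by
  wlog hab : a ≤ b generalizing a b
  · refine (this hb ha (le_of_not_ge hab)).neg.congr_fun (fun t _ => ?_) measurableSet_Ioi
    simp only [Pi.neg_apply, smul_eq_mul]; ring
  have hbound : IntegrableOn (fun t => (b - a) * Real.exp (-a * t)) (Ioi 0) :=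
    (exp_neg_integrableOn_Ioi 0 ha).const_mul _
  refine hbound.mono' (by fun_prop) ?_
  refine (ae_restrict_iff' measurableSet_Ioi).mpr (ae_of_all _ fun t (ht : 0 < t) => ?_)
  have h1 : Real.exp (-(b * t)) = Real.exp (-(a * t)) * Real.exp (-((b - a) * t)) := by
    rw [← Real.exp_add]; ring_nf
  have h2 := Real.one_sub_le_exp_neg ((b - a) * t)
  have h3 : Real.exp (-((b - a) * t)) ≤ 1 :=
    Real.exp_le_one_iff.mpr (by nlinarith)
  have h4 := Real.exp_pos (-(a * t))
  rw [h1, smul_eq_mul, Real.norm_eq_abs, abs_of_nonneg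
    (mul_nonneg (inv_nonneg.mpr ht.le) (by nlinarith)), neg_mul, inv_mul_le_iff₀ ht]
  nlinarith

lemma integral_exp_sub_exp_div {a b : ℝ} (ha : 0 < a) (hb : 0 < b) :
    ∫ t in Ioi 0, t⁻¹ • (Real.exp (-(a * t)) - Real.exp (-(b * t))) = Real.log (b / a) := by
  have h := Frullani.integral_Ioi_eq (f := fun t : ℝ => Real.exp (-t)) (L := 1) (R := 0)
    ((by fun_prop : Continuous fun t : ℝ => Real.exp (-t)).locallyIntegrable.locallyIntegrableOn _)
    ha hb
    ?_ ?_ (integrableOn_exp_sub_exp_div ha hb)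
  · simpa using h
  · have : Tendsto (fun t : ℝ => Real.exp (-t)) (𝓝 0) (𝓝 (Real.exp (-0))) :=
      (Continuous.tendsto (by fun_prop) 0)
    simp only [neg_zero, Real.exp_zero] at this
    exact this.mono_left nhdsWithin_le_nhds
  · exact Real.tendsto_exp_neg_atTop_nhds_zero

/-- The integrand in `-log |s| = ∫_0^∞ (exp (-t s²) - exp (-t)) / (2 t) dt`. -/
noncomputable def logKernel (s t : ℝ) : ℝ :=
  (Real.exp (-(t * s ^ 2)) - Real.exp (-t)) / (2 * t)

lemma logKernel_eq (s t : ℝ) :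
    logKernel s t = (1 / 2) * (t⁻¹ • (Real.exp (-(s ^ 2 * t)) - Real.exp (-(1 * t)))) := by
  simp only [logKernel, smul_eq_mul, one_mul, mul_comm t]
  rw [div_eq_mul_inv, mul_inv]; ring

lemma integrableOn_logKernel {s : ℝ} (hs : s ≠ 0) : IntegrableOn (logKernel s) (Ioi 0) := by
  have := (integrableOn_exp_sub_exp_div (a := s ^ 2) (by positivity) one_pos).const_mul (1 / 2)
  simp only [← logKernel_eq] at this
  exact this

lemma integral_logKernel {s : ℝ} (hs : s ≠ 0) :
    ∫ t in Ioi 0, logKernel s t = -Real.log s := by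
  simp only [logKernel_eq]
  rw [integral_const_mul, integral_exp_sub_exp_div (by positivity) one_pos,
    Real.log_div one_ne_zero (by positivity), Real.log_one, Real.log_pow]
  push_cast; ring

lemma integral_abs_logKernel {s : ℝ} (hs : s ≠ 0) :
    ∫ t in Ioi 0, |logKernel s t| = |Real.log s| := by
  -- the integrand has constant sign
  rcases le_total (s ^ 2) 1 with h | h
  · have e : ∫ t in Ioi 0, |logKernel s t| = ∫ t in Ioi 0, logKernel s t := by
      refine setIntegral_congr_fun measurableSet_Ioi fun t (ht : 0 < t) => abs_of_nonneg ?_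
      refine div_nonneg (sub_nonneg.mpr (Real.exp_le_exp.mpr ?_)) (by positivity)
      nlinarith
    have hl : Real.log s ≤ 0 := by
      have := Real.log_nonpos (sq_nonneg s) h
      rw [Real.log_pow] at this; push_cast at this; linarith
    rw [e, integral_logKernel hs, abs_of_nonpos hl]
  · have e : ∫ t in Ioi 0, |logKernel s t| = ∫ t in Ioi 0, -logKernel s t := by
      refine setIntegral_congr_fun measurableSet_Ioi fun t (ht : 0 < t) => abs_of_nonpos ?_
      refine div_nonpos_of_nonpos_of_nonneg (sub_nonpos.mpr (Real.exp_le_exp.mpr ?_))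
        (by positivity)
      nlinarith
    have hl : 0 ≤ Real.log s := by
      have := Real.log_nonneg h
      rw [Real.log_pow] at this; push_cast at this; linarith
    rw [e, integral_neg, integral_logKernel hs, abs_of_nonneg hl, neg_neg]

/-! ### Gaussian kernels are strictly positive definite -/

/-- The mutual Gaussian energy `∬ exp (-t (x - y)²) dp(x) dq(y)`. -/
noncomputable def gaussEnergy (t : ℝ) (p q : Measure ℝ) : ℝ :=
  ∫ z, Real.exp (-(t * (z.1 - z.2) ^ 2)) ∂(p.prod q)

lemma continuous_charFun_real (p : Measure ℝ) [IsProbabilityMeasure p] :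
    Continuous (charFun p) := continuous_charFun

/-- `exp (-t s²)` is the characteristic function of the centred Gaussian law of variance `2 t`. -/
lemma gaussEnergy_eq {t : ℝ} (ht : 0 ≤ t) (p q : Measure ℝ) [IsProbabilityMeasure p]
    [IsProbabilityMeasure q] :
    gaussEnergy t p q
      = ∫ g, (charFun p g * conj (charFun q g)).re ∂(gaussianReal 0 (2 * t).toNNReal) := by
  set γ := gaussianReal 0 (2 * t).toNNReal with hγ
  have hexp : ∀ s : ℝ, ((Real.exp (-(t * s ^ 2)) : ℝ) : ℂ)
      = ∫ g, Complex.exp (s * g * Complex.I) ∂γ := by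
    intro s
    rw [← charFun_apply_real, hγ, charFun_gaussianReal, Real.coe_toNNReal _ (by positivity)]
    push_cast
    congr 1
    ring
  have hint : Integrable (fun w : (ℝ × ℝ) × ℝ =>
      Complex.exp (((w.1.1 - w.1.2 : ℝ) : ℂ) * w.2 * Complex.I)) ((p.prod q).prod γ) := by
    refine Integrable.of_bound (C := 1) (by fun_prop) (ae_of_all _ fun w => ?_)
    rw [← Complex.ofReal_mul, Complex.norm_exp_ofReal_mul_I]
  have hc : ((gaussEnergy t p q : ℝ) : ℂ) = ∫ g, charFun p g * conj (charFun q g) ∂γ := by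
    unfold gaussEnergy
    rw [← integral_complex_ofReal]
    simp only [hexp]
    rw [integral_integral_swap hint]
    refine integral_congr_ae (ae_of_all _ fun g => ?_)
    simp only
    rw [← charFun_neg, charFun_apply_real, charFun_apply_real, ← integral_prod_mul]
    refine integral_congr_ae (ae_of_all _ fun z => ?_)
    simp only
    rw [← Complex.exp_add]
    push_cast
    ring_nf
  have hci : Integrable (fun g => charFun p g * conj (charFun q g)) γ := by
    refine Integrable.of_bound (C := 1) (Continuous.aestronglyMeasurable ?_)
      (ae_of_all _ fun g => ?_)
    · exact (continuous_charFun_real p).mul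
        (Complex.continuous_conj.comp (continuous_charFun_real q))
    · rw [norm_mul, RCLike.norm_conj]
      exact mul_le_one₀ (norm_charFun_le_one g) (norm_nonneg _) (norm_charFun_le_one g)
  have := congrArg Complex.re hc
  rw [Complex.ofReal_re] at this
  rw [this]
  exact (integral_re hci).symm

lemma integrable_norm_charFun_sub_sq (p q : Measure ℝ) [IsProbabilityMeasure p]
    [IsProbabilityMeasure q] (γ : Measure ℝ) [IsProbabilityMeasure γ] :
    Integrable (fun g => ‖charFun p g - charFun q g‖ ^ 2) γ := by
  refine Integrable.of_bound (C := 4) (Continuous.aestronglyMeasurable ?_)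
    (ae_of_all _ fun g => ?_)
  · exact ((continuous_charFun_real p).sub (continuous_charFun_real q)).norm.pow 2
  · have h : ‖charFun p g - charFun q g‖ ≤ 2 :=
      (norm_sub_le _ _).trans (by
        linarith [(norm_charFun_le_one g : ‖charFun p g‖ ≤ 1),
          (norm_charFun_le_one g : ‖charFun q g‖ ≤ 1)])
    rw [Real.norm_eq_abs, abs_of_nonneg (sq_nonneg _)]
    nlinarith [norm_nonneg (charFun p g - charFun q g)]

lemma gaussEnergy_sub {t : ℝ} (ht : 0 ≤ t) (p q : Measure ℝ) [IsProbabilityMeasure p]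
    [IsProbabilityMeasure q] :
    gaussEnergy t p p + gaussEnergy t q q - 2 * gaussEnergy t p q
      = ∫ g, ‖charFun p g - charFun q g‖ ^ 2 ∂(gaussianReal 0 (2 * t).toNNReal) := by
  have hi : ∀ (p q : Measure ℝ) [IsProbabilityMeasure p] [IsProbabilityMeasure q],
      Integrable (fun g => (charFun p g * conj (charFun q g)).re)
        (gaussianReal 0 (2 * t).toNNReal) := by
    intro p q _ _
    refine Integrable.of_bound (C := 1) (Continuous.aestronglyMeasurable ?_)
      (ae_of_all _ fun g => ?_)
    · exact Complex.continuous_re.comp ((continuous_charFun_real p).mul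
        (Complex.continuous_conj.comp (continuous_charFun_real q)))
    · refine (Complex.abs_re_le_norm _).trans ?_
      rw [norm_mul, RCLike.norm_conj]
      exact mul_le_one₀ (norm_charFun_le_one g) (norm_nonneg _) (norm_charFun_le_one g)
  rw [gaussEnergy_eq ht, gaussEnergy_eq ht, gaussEnergy_eq ht, ← integral_const_mul,
    ← integral_add (hi p p) (hi q q), ← integral_sub (by exact (hi p p).add (hi q q))
      ((hi p q).const_mul 2)]
  refine integral_congr_ae (ae_of_all _ fun g => ?_)
  simp only
  rw [← Complex.normSq_eq_norm_sq, Complex.normSq_apply]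
  simp
  ring

lemma gaussEnergy_sub_nonneg {t : ℝ} (ht : 0 ≤ t) (p q : Measure ℝ) [IsProbabilityMeasure p]
    [IsProbabilityMeasure q] :
    0 ≤ gaussEnergy t p p + gaussEnergy t q q - 2 * gaussEnergy t p q := by
  rw [gaussEnergy_sub ht]
  exact integral_nonneg fun g => sq_nonneg _

lemma eq_of_gaussEnergy_sub_eq_zero {t : ℝ} (ht : 0 < t) (p q : Measure ℝ)
    [IsProbabilityMeasure p] [IsProbabilityMeasure q]
    (h : gaussEnergy t p p + gaussEnergy t q q - 2 * gaussEnergy t p q = 0) : p = q := by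
  rw [gaussEnergy_sub ht.le,
    integral_eq_zero_iff_of_nonneg (fun g => sq_nonneg _)
      (integrable_norm_charFun_sub_sq p q _)] at h
  have hv : (2 * t).toNNReal ≠ 0 := by simpa using ht
  have h2 := (gaussianReal_absolutelyContinuous' 0 hv).ae_le h
  have h3 : charFun p =ᵐ[volume] charFun q := by
    filter_upwards [h2] with g hg
    simpa [sub_eq_zero] using hg
  exact Measure.ext_of_charFun
    ((Continuous.ae_eq_iff_eq volume (continuous_charFun_real p)
      (continuous_charFun_real q)).mp h3)

/-! ### Projections onto lines -/

/-- The unit vector `(-sin φ, cos φ)`, orthogonal to the direction with angle `φ`. -/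
noncomputable def normal (φ : ℝ) : Plane := !₂[-Real.sin φ, Real.cos φ]

/-- The scalar product of `x` with `normal φ`: the signed distance of `x` from the line
through the origin with angle `φ`. -/
noncomputable def height (φ : ℝ) (x : Plane) : ℝ := x 1 * Real.cos φ - x 0 * Real.sin φ

lemma inner_normal (φ : ℝ) (x : Plane) : inner ℝ x (normal φ) = height φ x := by
  simp [PiLp.inner_apply, Fin.sum_univ_two, normal, height]; ring

lemma height_sub (φ : ℝ) (x y : Plane) : height φ (x - y) = height φ x - height φ y := by
  simp [height]; ring

lemma continuous_height_uncurry : Continuous fun z : ℝ × Plane => height z.1 z.2 := by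
  unfold height; fun_prop

lemma continuous_height (φ : ℝ) : Continuous (height φ) := by
  unfold height; fun_prop

lemma continuous_normal : Continuous normal := by
  unfold normal; fun_prop

lemma charFun_smul_normal (ν : Measure Plane) (r φ : ℝ) :
    charFun ν (r • normal φ) = charFun (ν.map (height φ)) r := by
  rw [charFun_apply, charFun_apply_real, integral_map (continuous_height φ).aemeasurable
    (by fun_prop)]
  simp [inner_smul_right, inner_normal]

lemma exists_polar (x : Plane) : ∃ r θ : ℝ, 0 ≤ r ∧ x 0 = r * Real.cos θ ∧
    x 1 = r * Real.sin θ :=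
  ⟨‖(⟨x 0, x 1⟩ : ℂ)‖, (⟨x 0, x 1⟩ : ℂ).arg, norm_nonneg _,
    (Complex.norm_mul_cos_arg ⟨x 0, x 1⟩).symm, (Complex.norm_mul_sin_arg ⟨x 0, x 1⟩).symm⟩

/-- The Cramér–Wold device, for almost all projections. -/
lemma eq_of_ae_map_height_eq {ν μ : Measure Plane} [IsProbabilityMeasure ν]
    [IsProbabilityMeasure μ]
    (h : ∀ᵐ φ ∂(volume.restrict (Ioc 0 π)), ν.map (height φ) = μ.map (height φ)) : ν = μ := by
  have hIcc : ∀ r : ℝ, ∀ φ ∈ Icc 0 π, charFun ν (r • normal φ) = charFun μ (r • normal φ) := by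
    intro r
    have hc : Continuous fun φ => r • normal φ := continuous_normal.const_smul r
    refine Measure.eqOn_Icc_of_ae_eq volume Real.pi_pos.ne
      (f := fun φ => charFun ν (r • normal φ)) (g := fun φ => charFun μ (r • normal φ)) ?_
      (continuous_charFun.comp hc).continuousOn (continuous_charFun.comp hc).continuousOn
    rw [Measure.restrict_congr_set Ioc_ae_eq_Icc.symm]
    filter_upwards [h] with φ hφ
    rw [charFun_smul_normal, charFun_smul_normal, hφ]
  have hper : Function.Periodic
      (fun φ => ∀ r : ℝ, charFun ν (r • normal φ) = charFun μ (r • normal φ)) π := by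
    intro φ
    have e : ∀ r : ℝ, r • normal (φ + π) = (-r) • normal φ := by
      intro r
      ext i
      fin_cases i <;> simp [normal, Real.sin_add_pi, Real.cos_add_pi]
    simp only [e, eq_iff_iff]
    exact ⟨fun H r => by simpa using H (-r), fun H r => H (-r)⟩
  have hall : ∀ φ r : ℝ, charFun ν (r • normal φ) = charFun μ (r • normal φ) := by
    intro φ
    obtain ⟨ψ, hψ, he⟩ := hper.exists_mem_Ico₀ Real.pi_pos φ
    rw [he]
    exact fun r => hIcc r ψ ⟨hψ.1, hψ.2.le⟩
  refine Measure.ext_of_charFun (funext fun ξ => ?_)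
  obtain ⟨r, θ, -, h0, h1⟩ := exists_polar ξ
  have e : ξ = r • normal (θ - π / 2) := by
    ext i
    fin_cases i
    · simp [normal, h0, Real.sin_sub_pi_div_two]
    · simp [normal, h1, Real.cos_sub_pi_div_two]
  rw [e]
  exact hall _ _

/-! ### Projections of the ellipse law are semicircle laws -/

/-- The half-width `√(1 + α cos 2φ)` of the ellipse in the direction `normal φ`, that is, the
maximum of `height φ` on its closure. -/
noncomputable def halfWidth (α φ : ℝ) : ℝ := √(1 + α * Real.cos (2 * φ))

/-- The semicircle law on `[-1, 1]`, as a law of the angle `ψ` in the parametrisation `cos ψ`. -/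
noncomputable def semicircleAngle : Measure ℝ :=
  (volume.restrict (Ioo 0 π)).withDensity fun ψ => ENNReal.ofReal (2 / π * Real.sin ψ ^ 2)

section

variable {α : ℝ}

lemma one_sub_le_one_add_mul_cos (hα0 : 0 ≤ α) (φ : ℝ) :
    1 - α ≤ 1 + α * Real.cos (2 * φ) := by
  nlinarith [Real.neg_one_le_cos (2 * φ)]

lemma one_add_mul_cos_pos (hα0 : 0 ≤ α) (hα1 : α < 1) (φ : ℝ) :
    0 < 1 + α * Real.cos (2 * φ) := by
  linarith [one_sub_le_one_add_mul_cos hα0 φ]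

lemma halfWidth_pos (hα0 : 0 ≤ α) (hα1 : α < 1) (φ : ℝ) : 0 < halfWidth α φ :=
  Real.sqrt_pos.mpr (one_add_mul_cos_pos hα0 hα1 φ)

lemma halfWidth_sq (hα0 : 0 ≤ α) (hα1 : α < 1) (φ : ℝ) :
    halfWidth α φ ^ 2 = 1 + α * Real.cos (2 * φ) :=
  Real.sq_sqrt (one_add_mul_cos_pos hα0 hα1 φ).le

lemma halfWidth_le_two (hα0 : 0 ≤ α) (hα1 : α < 1) (φ : ℝ) : halfWidth α φ ≤ 2 := by
  rw [halfWidth, Real.sqrt_le_left (by norm_num)]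
  nlinarith [Real.cos_le_one (2 * φ)]

lemma continuous_halfWidth : Continuous (halfWidth α) := by
  unfold halfWidth; fun_prop

lemma halfWidth_sq_eq (hα0 : 0 ≤ α) (hα1 : α < 1) (φ : ℝ) :
    halfWidth α φ ^ 2 = (1 - α) * Real.sin φ ^ 2 + (1 + α) * Real.cos φ ^ 2 := by
  rw [halfWidth_sq hα0 hα1, Real.cos_two_mul']
  linear_combination -Real.sin_sq_add_cos_sq φ

lemma abs_height_le_halfWidth (hα0 : 0 ≤ α) (hα1 : α < 1) {x : Plane} (hx : x ∈ ellipse α)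
    (φ : ℝ) : |height φ x| ≤ halfWidth α φ := by
  refine abs_le_of_sq_le_sq ?_ (halfWidth_pos hα0 hα1 φ).le
  rw [halfWidth_sq_eq hα0 hα1]
  have h1 : 0 < 1 - α := by linarith
  have h2 : 0 < 1 + α := by linarith
  have hx' : x 0 ^ 2 / (1 - α) + x 1 ^ 2 / (1 + α) < 1 := hx
  set u := x 0 ^ 2 / (1 - α) with hu
  set v := x 1 ^ 2 / (1 + α) with hv
  have hu' : x 0 ^ 2 = (1 - α) * u := by rw [hu]; field_simp
  have hv' : x 1 ^ 2 = (1 + α) * v := by rw [hv]; field_simp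
  set K := (1 - α) * Real.sin φ ^ 2 + (1 + α) * Real.cos φ ^ 2 with hK
  have hK0 : 0 ≤ K := by positivity
  have hcs : height φ x ^ 2 ≤ (u + v) * K := by
    have hsq : (u + v) * K - height φ x ^ 2
        = ((1 - α) * x 1 * Real.sin φ + (1 + α) * x 0 * Real.cos φ) ^ 2
          / ((1 - α) * (1 + α)) := by
      rw [hu, hv, hK, height]; field_simp; ring
    have : 0 ≤ (u + v) * K - height φ x ^ 2 := by rw [hsq]; positivity
    linarith
  nlinarith

lemma measurableSet_ellipse (α : ℝ) : MeasurableSet (ellipse α) :=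
  measurableSet_lt (by fun_prop) measurable_const

lemma volume_sq_lt (r : ℝ) :
    volume {t : ℝ | r ^ 2 + t ^ 2 < 1} = ENNReal.ofReal (2 * √(1 - r ^ 2)) := by
  have : {t : ℝ | r ^ 2 + t ^ 2 < 1} = Ioo (-√(1 - r ^ 2)) (√(1 - r ^ 2)) := by
    ext t
    rw [mem_Ioo, ← abs_lt, Real.lt_sqrt (abs_nonneg t), sq_abs, mem_ofPred_eq]
    constructor <;> intro h <;> linarith
  rw [this, Real.volume_Ioo]
  ring_nf

/-- A linear map carries the unit disc to the ellipse and the first coordinate to a multiple of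
the function `height φ`; the disc is then cut into segments. -/
lemma setLIntegral_ellipse_height (hα0 : 0 ≤ α) (hα1 : α < 1) (φ : ℝ) {F : ℝ → ℝ≥0∞}
    (hF : Measurable F) :
    ∫⁻ y in ellipse α, F (height φ y) = ENNReal.ofReal √(1 - α ^ 2) *
      ∫⁻ s, F (halfWidth α φ * s) * ENNReal.ofReal (2 * √(1 - s ^ 2)) := by
  have h1 : 0 < 1 - α := by linarith
  have h2 : 0 < 1 + α := by linarith
  have hl := halfWidth_pos hα0 hα1 φ
  have hl2 := halfWidth_sq_eq hα0 hα1 φ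
  set l := halfWidth α φ with hldef
  set a := √(1 - α) with ha
  set b := √(1 + α) with hb
  have ha0 : 0 < a := Real.sqrt_pos.mpr h1
  have hb0 : 0 < b := Real.sqrt_pos.mpr h2
  have ha2 : a ^ 2 = 1 - α := Real.sq_sqrt h1.le
  have hb2 : b ^ 2 = 1 + α := Real.sq_sqrt h2.le
  have hsc := Real.sin_sq_add_cos_sq φ
  set c := Real.cos φ with hc
  set s := Real.sin φ with hs
  -- `(n₁, n₂)` is the direction in which `height φ` grows after the ellipse is rescaled to the disc
  set n₁ := -(a * s) / l with hn₁
  set n₂ := b * c / l with hn₂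
  have hn : n₁ ^ 2 + n₂ ^ 2 = 1 := by
    rw [hn₁, hn₂]; field_simp; rw [hl2, ← ha2, ← hb2]
  set M : Matrix (Fin 2) (Fin 2) ℝ := !![a * n₁, -(a * n₂); b * n₂, b * n₁] with hM
  have hdet : M.det = a * b := by
    rw [hM, Matrix.det_fin_two_of]; linear_combination (a * b) * hn
  have hdet0 : M.det ≠ 0 := by rw [hdet]; positivity
  have hab : a * b = √(1 - α ^ 2) := by
    rw [ha, hb, ← Real.sqrt_mul h1.le]; congr 1; ring
  set E : Set (Fin 2 → ℝ) := {y | y 0 ^ 2 / (1 - α) + y 1 ^ 2 / (1 + α) < 1} with hE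
  have hEm : MeasurableSet E := measurableSet_lt (by fun_prop) measurable_const
  set G : (Fin 2 → ℝ) → ℝ≥0∞ := E.indicator fun y => F (y 1 * c - y 0 * s) with hG
  have hGm : Measurable G := (hF.comp (by fun_prop)).indicator hEm
  set H : ℝ × ℝ → ℝ≥0∞ := {z : ℝ × ℝ | z.1 ^ 2 + z.2 ^ 2 < 1}.indicator fun z => F (l * z.1)
    with hH
  have hDm : MeasurableSet {z : ℝ × ℝ | z.1 ^ 2 + z.2 ^ 2 < 1} :=
    measurableSet_lt (by fun_prop) measurable_const
  have hHm : Measurable H := (hF.comp (by fun_prop)).indicator hDm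
  have step1 : ∫⁻ y in ellipse α, F (height φ y) = ∫⁻ y, G y := by
    rw [← (PiLp.volume_preserving_ofLp (Fin 2)).lintegral_comp hGm,
      ← lintegral_indicator (measurableSet_ellipse α)]
    rfl
  have hGM : ∀ v : Fin 2 → ℝ, G (Matrix.toLin' M v) = H (v 0, v 1) := by
    intro v
    have e0 : Matrix.toLin' M v 0 = a * (n₁ * v 0 - n₂ * v 1) := by
      simp [Matrix.toLin'_apply, hM, Matrix.mulVec, dotProduct, Fin.sum_univ_two]; ring
    have e1 : Matrix.toLin' M v 1 = b * (n₂ * v 0 + n₁ * v 1) := by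
      simp [Matrix.toLin'_apply, hM, Matrix.mulVec, dotProduct, Fin.sum_univ_two]; ring
    have hmem : Matrix.toLin' M v ∈ E ↔ (v 0, v 1) ∈ {z : ℝ × ℝ | z.1 ^ 2 + z.2 ^ 2 < 1} := by
      simp only [hE, mem_ofPred_eq, e0, e1, ← ha2, ← hb2, mul_pow]
      rw [mul_div_cancel_left₀ _ (by positivity), mul_div_cancel_left₀ _ (by positivity)]
      rw [show (n₁ * v 0 - n₂ * v 1) ^ 2 + (n₂ * v 0 + n₁ * v 1) ^ 2 = v 0 ^ 2 + v 1 ^ 2 by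
        linear_combination (v 0 ^ 2 + v 1 ^ 2) * hn]
    have hval : Matrix.toLin' M v 1 * c - Matrix.toLin' M v 0 * s = l * v 0 := by
      rw [e0, e1, hn₁, hn₂]
      field_simp
      rw [hl2, ← ha2, ← hb2]
      ring
    simp only [hG, hH, indicator, hmem, hval]
  have step2 : ∫⁻ y, G y = ENNReal.ofReal (a * b) * ∫⁻ v : Fin 2 → ℝ, H (v 0, v 1) := by
    have hmap := Real.map_matrix_volume_pi_eq_smul_volume_pi hdet0
    have hTm : Measurable (Matrix.toLin' M) := by fun_prop
    have := lintegral_map (μ := volume) hGm hTm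
    rw [hmap, lintegral_smul_measure] at this
    simp only [hGM, smul_eq_mul] at this
    rw [← this, ← mul_assoc, hdet, ← ENNReal.ofReal_mul (by positivity),
      abs_of_pos (by positivity), mul_inv_cancel₀ (by positivity)]
    simp
  have step3 : ∫⁻ v : Fin 2 → ℝ, H (v 0, v 1) = ∫⁻ z, H z :=
    (volume_preserving_finTwoArrow ℝ).lintegral_comp hHm
  rw [step1, step2, step3, hab, Measure.volume_eq_prod, lintegral_prod _ hHm.aemeasurable]
  congr 1
  refine lintegral_congr fun r => ?_
  have e : ∀ t, H (r, t) = {t : ℝ | r ^ 2 + t ^ 2 < 1}.indicator (fun _ => F (l * r)) t :=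
    fun t => rfl
  simp only [e]
  rw [lintegral_indicator (measurableSet_lt (by fun_prop) measurable_const),
    setLIntegral_const, volume_sq_lt]

lemma lintegral_sqrt_eq_lintegral_cos (K : ℝ → ℝ≥0∞) :
    ∫⁻ s, K s * ENNReal.ofReal (2 * √(1 - s ^ 2))
      = ∫⁻ ψ in Ioo 0 π, K (Real.cos ψ) * ENNReal.ofReal (2 * Real.sin ψ ^ 2) := by
  have himg : Real.cos '' Ioo 0 π = Ioo (-1) 1 := by
    ext s
    constructor
    · rintro ⟨ψ, hψ, rfl⟩
      constructor
      · rw [← Real.cos_pi]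
        exact Real.cos_lt_cos_of_nonneg_of_le_pi hψ.1.le le_rfl hψ.2
      · rw [← Real.cos_zero]
        exact Real.cos_lt_cos_of_nonneg_of_le_pi le_rfl hψ.2.le hψ.1
    · intro hs
      refine ⟨Real.arccos s, ⟨Real.arccos_pos.mpr hs.2, ?_⟩, Real.cos_arccos hs.1.le hs.2.le⟩
      refine lt_of_le_of_ne (Real.arccos_le_pi s) fun h => ?_
      rw [Real.arccos_eq_pi] at h
      linarith [hs.1]
  have h1 : ∫⁻ s, K s * ENNReal.ofReal (2 * √(1 - s ^ 2))
      = ∫⁻ s in Ioo (-1) 1, K s * ENNReal.ofReal (2 * √(1 - s ^ 2)) := by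
    rw [← lintegral_indicator measurableSet_Ioo]
    refine lintegral_congr fun s => ?_
    by_cases hs : s ∈ Ioo (-1 : ℝ) 1
    · rw [indicator_of_mem hs]
    · rw [indicator_of_notMem hs]
      have : 1 - s ^ 2 ≤ 0 := by
        rw [mem_Ioo, ← abs_lt, not_lt] at hs
        nlinarith [sq_abs s]
      rw [Real.sqrt_eq_zero'.mpr this]; simp
  rw [h1, ← himg, lintegral_image_eq_lintegral_abs_deriv_mul measurableSet_Ioo
    (fun x _ => (Real.hasDerivAt_cos x).hasDerivWithinAt)
    (Real.injOn_cos.mono Ioo_subset_Icc_self)]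
  refine setLIntegral_congr_fun measurableSet_Ioo fun ψ hψ => ?_
  have hs := Real.sin_pos_of_mem_Ioo hψ
  rw [← Real.sin_sq, Real.sqrt_sq hs.le, abs_neg, abs_of_pos hs, mul_left_comm,
    ← ENNReal.ofReal_mul hs.le]
  ring_nf

/-- The projection of the ellipse law onto a line is a semicircle law. -/
lemma map_height_ellipseLaw (hα0 : 0 ≤ α) (hα1 : α < 1) (φ : ℝ) :
    (ellipseLaw α).map (height φ)
      = semicircleAngle.map fun ψ => halfWidth α φ * Real.cos ψ := by
  refine Measure.ext_of_lintegral _ fun F hF => ?_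
  have hp := Real.pi_pos
  have hs : 0 < √(1 - α ^ 2) := Real.sqrt_pos.mpr (by nlinarith)
  rw [lintegral_map hF (continuous_height φ).measurable, lintegral_map hF (by fun_prop),
    ellipseLaw, lintegral_smul_measure, setLIntegral_ellipse_height hα0 hα1 φ hF,
    lintegral_sqrt_eq_lintegral_cos (fun s => F (halfWidth α φ * s)), semicircleAngle,
    lintegral_withDensity_eq_lintegral_mul _ (by fun_prop)
      (by fun_prop : Measurable fun ψ => F (halfWidth α φ * Real.cos ψ)),
    smul_eq_mul, ← mul_assoc, ← ENNReal.ofReal_mul (by positivity),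
    ← lintegral_const_mul' _ _ ENNReal.ofReal_ne_top]
  refine lintegral_congr fun ψ => ?_
  simp only [Pi.mul_apply]
  rw [mul_left_comm, ← ENNReal.ofReal_mul (by positivity), mul_comm]
  congr 2
  field_simp

lemma integrable_semicircleAngle_iff {f : ℝ → ℝ} :
    Integrable f semicircleAngle
      ↔ IntervalIntegrable (fun ψ => 2 / π * Real.sin ψ ^ 2 * f ψ) volume 0 π := by
  have hp := Real.pi_pos
  rw [semicircleAngle, integrable_withDensity_iff_integrable_smul' (by fun_prop) (by simp),
    intervalIntegrable_iff_integrableOn_Ioo_of_le hp.le, IntegrableOn]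
  refine integrable_congr (ae_of_all _ fun ψ => ?_)
  simp only
  rw [ENNReal.toReal_ofReal (by positivity), smul_eq_mul]

lemma integral_semicircleAngle (f : ℝ → ℝ) :
    ∫ ψ, f ψ ∂semicircleAngle = ∫ ψ in 0..π, 2 / π * Real.sin ψ ^ 2 * f ψ := by
  have hp := Real.pi_pos
  rw [semicircleAngle, integral_withDensity_eq_integral_toReal_smul (by fun_prop) (by simp),
    intervalIntegral.integral_of_le hp.le, integral_Ioc_eq_integral_Ioo]
  refine integral_congr_ae (ae_of_all _ fun ψ => ?_)
  simp only
  rw [ENNReal.toReal_ofReal (by positivity), smul_eq_mul]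

instance isProbabilityMeasure_semicircleAngle : IsProbabilityMeasure semicircleAngle := by
  have hp := Real.pi_pos
  constructor
  have h1 : Integrable (fun _ => (1 : ℝ)) semicircleAngle :=
    integrable_semicircleAngle_iff.mpr (Continuous.intervalIntegrable (by fun_prop) _ _)
  have h2 := integral_semicircleAngle fun _ => 1
  have hfin : semicircleAngle univ < ∞ := by
    have := h1.hasFiniteIntegral
    simpa [HasFiniteIntegral] using this
  simp only [integral_const, smul_eq_mul, mul_one, intervalIntegral.integral_const_mul,
    integral_sin_sq, Measure.real] at h2
  rw [← ENNReal.toReal_eq_one_iff, h2]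
  simp

/-- The total mass is read off from a projection. -/
lemma isProbabilityMeasure_ellipseLaw (hα0 : 0 ≤ α) (hα1 : α < 1) :
    IsProbabilityMeasure (ellipseLaw α) := by
  have h : IsProbabilityMeasure ((ellipseLaw α).map (height 0)) := by
    rw [map_height_ellipseLaw hα0 hα1]
    exact Measure.isProbabilityMeasure_map (by fun_prop)
  exact Measure.isProbabilityMeasure_of_map (height 0)

/-! ### Logarithmic potentials of the projections -/

lemma integrable_log_sub_height (hα0 : 0 ≤ α) (hα1 : α < 1) (φ s : ℝ) :
    Integrable (fun y => Real.log (s - height φ y)) (ellipseLaw α) ∧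
    ∫ y, Real.log (s - height φ y) ∂(ellipseLaw α) = Real.log (halfWidth α φ)
      + 2 / π * ∫ ψ in 0..π, Real.log (s / halfWidth α φ - Real.cos ψ) * Real.sin ψ ^ 2 := by
  have hl := halfWidth_pos hα0 hα1 φ
  set l := halfWidth α φ with hldef
  have hm : Measurable fun u => Real.log (s - u) := by fun_prop
  have hi := intervalIntegrable_log_sub_cos_mul (s / l) (g := fun ψ => Real.sin ψ ^ 2)
    (by fun_prop) 0 π
  -- off the zero of `s - l cos ψ` the factor `l` can be taken out of the logarithm
  have hae : ∀ᵐ ψ ∂(volume.restrict (Ioc 0 π)),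
      2 / π * Real.sin ψ ^ 2 * Real.log (s - l * Real.cos ψ)
      = 2 / π * Real.log l * Real.sin ψ ^ 2
        + 2 / π * (Real.log (s / l - Real.cos ψ) * Real.sin ψ ^ 2) := by
    have hne : ∀ᵐ ψ ∂(volume.restrict (Ioc 0 π)), ψ ≠ Real.arccos (s / l) :=
      ae_restrict_of_ae (by simp [ae_iff])
    filter_upwards [hne, ae_restrict_mem measurableSet_Ioc] with ψ h hψ
    have h0 : s / l - Real.cos ψ ≠ 0 := by
      intro h0
      apply h
      rw [sub_eq_zero.mp h0, Real.arccos_cos hψ.1.le hψ.2]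
    have e : s - l * Real.cos ψ = l * (s / l - Real.cos ψ) := by field_simp
    rw [e, Real.log_mul hl.ne' h0]
    ring
  have hint : IntervalIntegrable (fun ψ => 2 / π * Real.log l * Real.sin ψ ^ 2
      + 2 / π * (Real.log (s / l - Real.cos ψ) * Real.sin ψ ^ 2)) volume 0 π :=
    (Continuous.intervalIntegrable (by fun_prop) _ _).add (hi.const_mul _)
  constructor
  · have h1 : Integrable (fun ψ => Real.log (s - l * Real.cos ψ)) semicircleAngle := by
      rw [integrable_semicircleAngle_iff, intervalIntegrable_iff_integrableOn_Ioc_of_le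
        Real.pi_pos.le]
      rw [intervalIntegrable_iff_integrableOn_Ioc_of_le Real.pi_pos.le] at hint
      exact Integrable.congr hint (hae.mono fun _ h => h.symm)
    have h2 : Integrable (fun u => Real.log (s - u)) ((ellipseLaw α).map (height φ)) := by
      rw [map_height_ellipseLaw hα0 hα1]
      exact (integrable_map_measure hm.aestronglyMeasurable (by fun_prop)).mpr h1
    exact (integrable_map_measure hm.aestronglyMeasurable
      (continuous_height φ).aemeasurable).mp h2
  · have h1 := integral_map (μ := ellipseLaw α) (continuous_height φ).aemeasurable
      (f := fun u => Real.log (s - u)) hm.aestronglyMeasurable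
    rw [map_height_ellipseLaw hα0 hα1, integral_map (by fun_prop) hm.aestronglyMeasurable,
      integral_semicircleAngle] at h1
    rw [← h1, intervalIntegral.integral_of_le Real.pi_pos.le, integral_congr_ae hae,
      ← intervalIntegral.integral_of_le Real.pi_pos.le,
      intervalIntegral.integral_add (Continuous.intervalIntegrable (by fun_prop) _ _)
        (hi.const_mul _), intervalIntegral.integral_const_mul,
      intervalIntegral.integral_const_mul, integral_sin_sq]
    have hp := Real.pi_pos
    simp
    field_simp

lemma integral_log_sub_height_le (hα0 : 0 ≤ α) (hα1 : α < 1) (φ s : ℝ) :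
    ∫ y, Real.log (s - height φ y) ∂(ellipseLaw α)
      ≤ Real.log (halfWidth α φ) + s ^ 2 / halfWidth α φ ^ 2 - 1 / 2 - Real.log 2 := by
  have hp := Real.pi_pos
  rw [(integrable_log_sub_height hα0 hα1 φ s).2]
  have h := mul_le_mul_of_nonneg_left (integral_log_sub_cos_le (s / halfWidth α φ))
    (show 0 ≤ 2 / π by positivity)
  have e : 2 / π * (π / 2 * ((s / halfWidth α φ) ^ 2 - 1 / 2 - Real.log 2))
      = s ^ 2 / halfWidth α φ ^ 2 - 1 / 2 - Real.log 2 := by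
    rw [div_pow]; field_simp
  linarith

lemma integral_log_sub_height_eq (hα0 : 0 ≤ α) (hα1 : α < 1) {φ s : ℝ}
    (hs : |s| ≤ halfWidth α φ) :
    ∫ y, Real.log (s - height φ y) ∂(ellipseLaw α)
      = Real.log (halfWidth α φ) + s ^ 2 / halfWidth α φ ^ 2 - 1 / 2 - Real.log 2 := by
  have hp := Real.pi_pos
  have hl := halfWidth_pos hα0 hα1 φ
  rw [(integrable_log_sub_height hα0 hα1 φ s).2, integral_log_sub_cos_of_abs_le, div_pow]
  · field_simp; ring
  · rwa [abs_div, abs_of_pos hl, div_le_one hl]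

lemma le_integral_log_sub_height (hα0 : 0 ≤ α) (hα1 : α < 1) (φ s : ℝ) :
    Real.log (1 - α) / 2 - 1 / 2 - Real.log 2
      ≤ ∫ y, Real.log (s - height φ y) ∂(ellipseLaw α) := by
  have hp := Real.pi_pos
  rw [(integrable_log_sub_height hα0 hα1 φ s).2]
  have h := mul_le_mul_of_nonneg_left (le_integral_log_sub_cos (s / halfWidth α φ))
    (show 0 ≤ 2 / π by positivity)
  have e : 2 / π * (π / 2 * (-(1 / 2) - Real.log 2)) = -(1 / 2) - Real.log 2 := by field_simp
  have h2 : Real.log (1 - α) / 2 ≤ Real.log (halfWidth α φ) := by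
    rw [halfWidth, Real.log_sqrt (one_add_mul_cos_pos hα0 hα1 φ).le]
    have := Real.log_le_log (by linarith) (one_sub_le_one_add_mul_cos hα0 φ)
    linarith
  linarith

end

/-! ### The plane wave decomposition of the interaction -/

/-- The interaction potential `W_α` as a real function, with a junk value at the origin. -/
noncomputable def realW (α : ℝ) (x : Plane) : ℝ :=
  -(1 / 2) * Real.log (x 0 ^ 2 + x 1 ^ 2) + α * (x 0 ^ 2 / (x 0 ^ 2 + x 1 ^ 2))

/-- The weight of the direction `φ` in the plane wave decomposition of `W_α`. -/
noncomputable def weight (α φ : ℝ) : ℝ := (1 + α * Real.cos (2 * φ)) / π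

section

variable {α : ℝ}

lemma norm_sq_eq_add_sq (x : Plane) : ‖x‖ ^ 2 = x 0 ^ 2 + x 1 ^ 2 := by
  rw [EuclideanSpace.norm_sq_eq]; simp [Fin.sum_univ_two]

lemma measurable_realW (α : ℝ) : Measurable (realW α) := by
  unfold realW; fun_prop

lemma W_eq_realW {x : Plane} (hx : x ≠ 0) : W α x = (realW α x : EReal) := by
  rw [W, if_neg hx, realW]

lemma continuous_weight : Continuous (weight α) := by
  unfold weight; fun_prop

lemma weight_pos (hα0 : 0 ≤ α) (hα1 : α < 1) (φ : ℝ) : 0 < weight α φ :=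
  div_pos (one_add_mul_cos_pos hα0 hα1 φ) Real.pi_pos

lemma integral_weight : ∫ φ in 0..π, weight α φ = 1 := by
  have hp := Real.pi_pos
  unfold weight
  rw [intervalIntegral.integral_div, intervalIntegral.integral_add (by simp)
    (Continuous.intervalIntegrable (by fun_prop) _ _), intervalIntegral.integral_const_mul,
    intervalIntegral.integral_comp_mul_left (fun x => Real.cos x) two_ne_zero]
  simp [hp.ne']

lemma height_polar {x : Plane} {r θ : ℝ} (h0 : x 0 = r * Real.cos θ) (h1 : x 1 = r * Real.sin θ)
    (φ : ℝ) : height φ x = -(r * Real.sin (φ - θ)) := by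
  rw [height, h0, h1, Real.sin_sub]; ring

lemma ae_sin_sub_ne_zero (θ : ℝ) : ∀ᵐ φ : ℝ, Real.sin (φ - θ) ≠ 0 := by
  have hc : (range fun n : ℤ => (n : ℝ) * π + θ).Countable := countable_range _
  filter_upwards [hc.ae_notMem volume] with φ hφ h
  obtain ⟨n, hn⟩ := Real.sin_eq_zero_iff.mp h
  exact hφ ⟨n, by simp [hn]⟩

lemma exists_polar_pos {x : Plane} (hx : x ≠ 0) : ∃ θ : ℝ, 0 < ‖x‖ ∧
    x 0 = ‖x‖ * Real.cos θ ∧ x 1 = ‖x‖ * Real.sin θ := by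
  obtain ⟨r, θ, hr, h0, h1⟩ := exists_polar x
  have hr2 : ‖x‖ = r := by
    rw [← abs_of_nonneg hr, ← abs_of_nonneg (norm_nonneg x), ← sq_eq_sq_iff_abs_eq_abs,
      norm_sq_eq_add_sq, h0, h1]
    linear_combination r ^ 2 * Real.sin_sq_add_cos_sq θ
  exact ⟨θ, norm_pos_iff.mpr hx, by rw [hr2]; exact h0, by rw [hr2]; exact h1⟩

lemma ae_height_ne_zero {x : Plane} (hx : x ≠ 0) : ∀ᵐ φ : ℝ, height φ x ≠ 0 := by
  obtain ⟨θ, hr, h0, h1⟩ := exists_polar_pos hx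
  filter_upwards [ae_sin_sub_ne_zero θ] with φ hφ
  rw [height_polar h0 h1]
  exact neg_ne_zero.mpr (mul_ne_zero hr.ne' hφ)

lemma intervalIntegrable_log_height (x : Plane) (a b : ℝ) :
    IntervalIntegrable (fun φ => Real.log (height φ x)) volume a b := by
  have h : AnalyticOnNhd ℝ (fun φ => height φ x) univ :=
    (analyticOnNhd_const.mul Real.analyticOnNhd_cos).sub
      (analyticOnNhd_const.mul Real.analyticOnNhd_sin)
  exact (h.mono (subset_univ _)).meromorphicOn.intervalIntegrable_log

/-- The decomposition of `W_α` into logarithmic plane waves: the weight has Fourier modes `0` and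
`2`, which `log |sin|` turns into the isotropic and the anisotropic part of `W_α`. -/
lemma realW_eq_integral {x : Plane} (hx : x ≠ 0) :
    realW α x = α / 2 - Real.log 2 - ∫ φ in 0..π, weight α φ * Real.log (height φ x) := by
  have hp := Real.pi_pos
  obtain ⟨θ, hr, h0, h1⟩ := exists_polar_pos hx
  set r := ‖x‖ with hrdef
  have h2 : ∫ φ in 0..π, weight α φ * Real.log (height φ x)
      = ∫ φ in 0..π, (Real.log r * weight α φ + 1 / π * (Real.log (Real.sin (φ - θ))
        * (1 + α * Real.cos (2 * φ) + 0 * Real.cos (4 * φ)))) := by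
    refine intervalIntegral.integral_congr_ae ?_
    filter_upwards [ae_sin_sub_ne_zero θ] with φ hφ _
    rw [height_polar h0 h1, Real.log_neg_eq_log, Real.log_mul hr.ne' hφ, weight]
    ring
  have hsum : x 0 ^ 2 + x 1 ^ 2 = r ^ 2 := by rw [hrdef, norm_sq_eq_add_sq]
  rw [h2, intervalIntegral.integral_add
    ((continuous_weight.intervalIntegrable _ _).const_mul _)
    ((intervalIntegrable_log_sin_sub_mul (by fun_prop) θ 0 π).const_mul _),
    intervalIntegral.integral_const_mul, intervalIntegral.integral_const_mul, integral_weight,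
    integral_log_sin_sub_mul, realW, hsum, h0, Real.log_pow, mul_pow,
    mul_div_cancel_left₀ _ (by positivity), Real.cos_sq]
  field_simp
  push_cast
  ring

lemma integral_abs_log_height_le {x : Plane} (hx : x ≠ 0) :
    ∫ φ in 0..π, |Real.log (height φ x)|
      ≤ π * |Real.log ‖x‖| + ∫ φ in 0..π, |Real.log (Real.sin φ)| := by
  obtain ⟨θ, hr, h0, h1⟩ := exists_polar_pos hx
  have hper : Function.Periodic (fun φ => |Real.log (Real.sin φ)|) π :=
    fun φ => congrArg _ (periodic_log_sin φ)
  have hshift : ∫ φ in 0..π, |Real.log (Real.sin (φ - θ))|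
      = ∫ φ in 0..π, |Real.log (Real.sin φ)| := by
    have h2 := hper.intervalIntegral_add_eq (0 - θ) 0
    rw [intervalIntegral.integral_comp_sub_right (fun φ => |Real.log (Real.sin φ)|) θ,
      show π - θ = 0 - θ + π by ring, h2, zero_add]
  have hi : IntervalIntegrable (fun φ => |Real.log (Real.sin (φ - θ))|) volume 0 π := by
    simpa using (intervalIntegrable_log_sin_sub_mul (g := fun _ => 1) (by fun_prop) θ 0 π).abs
  have hmono : ∫ φ in 0..π, |Real.log (height φ x)|
      ≤ ∫ φ in 0..π, (|Real.log ‖x‖| + |Real.log (Real.sin (φ - θ))|) := by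
    refine intervalIntegral.integral_mono_ae Real.pi_pos.le
      (intervalIntegrable_log_height x 0 π).abs ((by simp : IntervalIntegrable _ _ _ _).add hi) ?_
    filter_upwards [ae_sin_sub_ne_zero θ] with φ hφ
    rw [height_polar h0 h1, Real.log_neg_eq_log, Real.log_mul hr.ne' hφ]
    exact abs_add_le _ _
  rw [intervalIntegral.integral_add (by simp) hi, hshift] at hmono
  simpa using hmono

/-! ### The potential of the ellipse law -/

lemma abs_log_le (u : ℝ) : |Real.log u| ≤ 2 * |u| - Real.log u := by
  have h := abs_nonneg u
  rcases le_total 0 (Real.log u) with h0 | h0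
  · have h1 : Real.log u ≤ |u| := by
      rw [← Real.log_abs]; exact Real.log_le_self h
    rw [abs_of_nonneg h0]; linarith
  · rw [abs_of_nonpos h0]; linarith

lemma abs_height_le (φ : ℝ) (x : Plane) : |height φ x| ≤ ‖x‖ := by
  refine abs_le_of_sq_le_sq ?_ (norm_nonneg x)
  rw [norm_sq_eq_add_sq, height]
  have e : x 0 ^ 2 + x 1 ^ 2 - (x 1 * Real.cos φ - x 0 * Real.sin φ) ^ 2
      = (x 0 * Real.cos φ + x 1 * Real.sin φ) ^ 2 := by
    linear_combination (-(x 0 ^ 2 + x 1 ^ 2)) * Real.sin_sq_add_cos_sq φ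
  nlinarith [sq_nonneg (x 0 * Real.cos φ + x 1 * Real.sin φ)]

lemma ae_mem_ellipse (α : ℝ) : ∀ᵐ y ∂(ellipseLaw α), y ∈ ellipse α :=
  Measure.ae_smul_measure (ae_restrict_mem (measurableSet_ellipse α)) _

lemma ellipseLaw_singleton (α : ℝ) (x : Plane) : ellipseLaw α {x} = 0 := by
  simp [ellipseLaw]

lemma ae_ne_ellipseLaw (α : ℝ) (x : Plane) : ∀ᵐ y ∂(ellipseLaw α), x - y ≠ 0 := by
  have h : ∀ᵐ y ∂(ellipseLaw α), y ∉ ({x} : Set Plane) :=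
    measure_eq_zero_iff_ae_notMem.mp (ellipseLaw_singleton α x)
  filter_upwards [h] with y hy
  exact fun h0 => hy (sub_eq_zero.mp h0).symm

lemma measurable_log_height_sub (x : Plane) :
    Measurable fun z : Plane × ℝ => Real.log (height z.2 (x - z.1)) := by
  refine Real.measurable_log.comp (Continuous.measurable ?_)
  exact continuous_height_uncurry.comp (continuous_snd.prodMk (continuous_const.sub continuous_fst))

/-- A bound for the mean of `|log |height φ (x - y)||` over the ellipse law that is uniform in
the direction `φ`. -/
noncomputable def logBound (α : ℝ) (x : Plane) : ℝ :=
  2 * (‖x‖ + 2) - (Real.log (1 - α) / 2 - 1 / 2 - Real.log 2)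

lemma integrable_log_height_sub (hα0 : 0 ≤ α) (hα1 : α < 1) (x : Plane) (φ : ℝ) :
    Integrable (fun y => Real.log (height φ (x - y))) (ellipseLaw α) := by
  simp only [height_sub]
  exact (integrable_log_sub_height hα0 hα1 φ _).1

lemma integral_abs_log_height_sub_le (hα0 : 0 ≤ α) (hα1 : α < 1) (x : Plane) (φ : ℝ) :
    ∫ y, |Real.log (height φ (x - y))| ∂(ellipseLaw α) ≤ logBound α x := by
  have := isProbabilityMeasure_ellipseLaw hα0 hα1
  have hi := integrable_log_height_sub hα0 hα1 x φ
  have h1 : ∫ y, |Real.log (height φ (x - y))| ∂(ellipseLaw α)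
      ≤ ∫ y, (2 * (‖x‖ + 2) - Real.log (height φ (x - y))) ∂(ellipseLaw α) := by
    refine integral_mono_ae hi.abs ((integrable_const _).sub hi) ?_
    filter_upwards [ae_mem_ellipse α] with y hy
    refine (abs_log_le _).trans ?_
    have h2 := abs_sub (height φ x) (height φ y)
    have h3 := abs_height_le_halfWidth hα0 hα1 hy φ
    have h4 := halfWidth_le_two hα0 hα1 φ
    have h5 := abs_height_le φ x
    rw [← height_sub] at h2
    linarith
  rw [integral_sub (integrable_const _) hi] at h1
  have h6 := le_integral_log_sub_height hα0 hα1 φ (height φ x)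
  simp only [← height_sub] at h6
  simp only [integral_const, smul_eq_mul, probReal_univ, one_mul] at h1
  rw [logBound]
  linarith

lemma integrable_weight_mul_log_height (hα0 : 0 ≤ α) (hα1 : α < 1) (x : Plane) :
    Integrable (fun z : Plane × ℝ => weight α z.2 * Real.log (height z.2 (x - z.1)))
      ((ellipseLaw α).prod (volume.restrict (Ioc 0 π))) := by
  have := isProbabilityMeasure_ellipseLaw hα0 hα1
  have hm : Measurable fun z : Plane × ℝ => weight α z.2 * Real.log (height z.2 (x - z.1)) :=
    (continuous_weight.measurable.comp measurable_snd).mul (measurable_log_height_sub x)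
  rw [integrable_prod_iff' hm.aestronglyMeasurable]
  refine ⟨ae_of_all _ fun φ => (integrable_log_height_sub hα0 hα1 x φ).const_mul (weight α φ), ?_⟩
  have hw : Integrable (fun φ => weight α φ * logBound α x) (volume.restrict (Ioc 0 π)) :=
    ((continuous_weight.integrableOn_Icc).mono_set Ioc_subset_Icc_self).mul_const _
  refine hw.mono' hm.norm.stronglyMeasurable.integral_prod_left'.aestronglyMeasurable
    (ae_of_all _ fun φ => ?_)
  have hw0 := weight_pos hα0 hα1 φ
  rw [Real.norm_eq_abs, abs_of_nonneg (integral_nonneg fun y => norm_nonneg _)]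
  simp only [norm_mul, Real.norm_eq_abs, abs_of_pos hw0]
  rw [integral_const_mul]
  exact mul_le_mul_of_nonneg_left (integral_abs_log_height_sub_le hα0 hα1 x φ) hw0.le

lemma realW_sub_eq (x : Plane) {y : Plane} (h : x - y ≠ 0) : realW α (x - y)
    = α / 2 - Real.log 2
      - ∫ φ in Ioc 0 π, weight α φ * Real.log (height φ (x - y)) := by
  rw [realW_eq_integral h, intervalIntegral.integral_of_le Real.pi_pos.le]

lemma integrable_realW_sub (hα0 : 0 ≤ α) (hα1 : α < 1) (x : Plane) :
    Integrable (fun y => realW α (x - y)) (ellipseLaw α) := by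
  have := isProbabilityMeasure_ellipseLaw hα0 hα1
  have h := (integrable_const (α / 2 - Real.log 2)).sub
    (integrable_weight_mul_log_height hα0 hα1 x).integral_prod_left
  refine h.congr ?_
  filter_upwards [ae_ne_ellipseLaw α x] with y hy
  exact (realW_sub_eq x hy).symm

lemma integral_realW_sub (hα0 : 0 ≤ α) (hα1 : α < 1) (x : Plane) :
    ∫ y, realW α (x - y) ∂(ellipseLaw α) = α / 2 - Real.log 2 - ∫ φ in 0..π,
      weight α φ * ∫ y, Real.log (height φ x - height φ y) ∂(ellipseLaw α) := by
  have := isProbabilityMeasure_ellipseLaw hα0 hα1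
  have hI := integrable_weight_mul_log_height hα0 hα1 x
  have h1 : ∫ y, realW α (x - y) ∂(ellipseLaw α) = ∫ y, (α / 2 - Real.log 2
      - ∫ φ in Ioc 0 π, weight α φ * Real.log (height φ (x - y))) ∂(ellipseLaw α) := by
    refine integral_congr_ae ?_
    filter_upwards [ae_ne_ellipseLaw α x] with y hy
    exact realW_sub_eq x hy
  rw [h1, integral_sub (integrable_const _) hI.integral_prod_left, integral_integral_swap hI,
    intervalIntegral.integral_of_le Real.pi_pos.le]
  simp [integral_const_mul, height_sub]

lemma intervalIntegrable_weight_mul_integral_log (hα0 : 0 ≤ α) (hα1 : α < 1) (x : Plane) :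
    IntervalIntegrable (fun φ => weight α φ
      * ∫ y, Real.log (height φ x - height φ y) ∂(ellipseLaw α)) volume 0 π := by
  have := isProbabilityMeasure_ellipseLaw hα0 hα1
  have h := (integrable_weight_mul_log_height hα0 hα1 x).integral_prod_right
  rw [intervalIntegrable_iff_integrableOn_Ioc_of_le Real.pi_pos.le]
  simp only [integral_const_mul, height_sub] at h
  exact h

lemma integral_abs_realW_sub_le (hα0 : 0 ≤ α) (hα1 : α < 1) (x : Plane) :
    ∫ y, |realW α (x - y)| ∂(ellipseLaw α) ≤ |α / 2 - Real.log 2| + logBound α x := by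
  have := isProbabilityMeasure_ellipseLaw hα0 hα1
  have hI := (integrable_weight_mul_log_height hα0 hα1 x).norm
  have h1 : ∫ y, |realW α (x - y)| ∂(ellipseLaw α) ≤ ∫ y, (|α / 2 - Real.log 2|
      + ∫ φ in Ioc 0 π, ‖weight α φ * Real.log (height φ (x - y))‖) ∂(ellipseLaw α) := by
    refine integral_mono_ae (integrable_realW_sub hα0 hα1 x).abs
      ((integrable_const _).add hI.integral_prod_left) ?_
    filter_upwards [ae_ne_ellipseLaw α x] with y hy
    rw [realW_sub_eq x hy]
    exact (abs_sub _ _).trans (add_le_add le_rfl abs_integral_le_integral_abs)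
  rw [integral_add (integrable_const _) hI.integral_prod_left, integral_integral_swap hI] at h1
  have h2 : ∫ φ in Ioc 0 π, ∫ y, ‖weight α φ * Real.log (height φ (x - y))‖ ∂(ellipseLaw α)
      ≤ ∫ φ in Ioc 0 π, weight α φ * logBound α x := by
    refine integral_mono_ae hI.integral_prod_right
      (((continuous_weight.integrableOn_Icc).mono_set Ioc_subset_Icc_self).mul_const _)
      (ae_of_all _ fun φ => ?_)
    have hw0 := weight_pos hα0 hα1 φ
    simp only [norm_mul, Real.norm_eq_abs, abs_of_pos hw0]
    rw [integral_const_mul]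
    exact mul_le_mul_of_nonneg_left (integral_abs_log_height_sub_le hα0 hα1 x φ) hw0.le
  rw [integral_mul_const,
    ← intervalIntegral.integral_of_le (f := weight α) Real.pi_pos.le, integral_weight,
    one_mul] at h2
  simp only [integral_const, smul_eq_mul, probReal_univ, one_mul] at h1
  linarith

lemma integral_height_sq (x : Plane) : ∫ φ in 0..π, height φ x ^ 2 / π = ‖x‖ ^ 2 / 2 := by
  have hp := Real.pi_pos
  have e : ∀ φ, height φ x ^ 2 / π = x 1 ^ 2 / π * Real.cos φ ^ 2
      - 2 * x 0 * x 1 / π * (Real.sin φ * Real.cos φ) + x 0 ^ 2 / π * Real.sin φ ^ 2 := by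
    intro φ; rw [height]; ring
  simp only [e]
  rw [intervalIntegral.integral_add (Continuous.intervalIntegrable (by fun_prop) _ _)
      (Continuous.intervalIntegrable (by fun_prop) _ _),
    intervalIntegral.integral_sub (Continuous.intervalIntegrable (by fun_prop) _ _)
      (Continuous.intervalIntegrable (by fun_prop) _ _),
    intervalIntegral.integral_const_mul, intervalIntegral.integral_const_mul,
    intervalIntegral.integral_const_mul, integral_cos_sq, integral_sin_sq,
    integral_sin_mul_cos₁, norm_sq_eq_add_sq]
  simp
  field_simp
  ring

/-- The constant of the Euler–Lagrange conditions, as it comes out of the plane wave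
decomposition. -/
lemma integral_weight_mul_log_halfWidth (hα0 : 0 ≤ α) (hα1 : α < 1) :
    ∫ φ in 0..π, weight α φ * (Real.log (halfWidth α φ) - 1 / 2 - Real.log 2)
      = α / 2 - Real.log 2 - ellipseConst α := by
  have hp := Real.pi_pos
  have h1 : 0 < 1 - α := by linarith
  have h2 : 0 < 1 + α := by linarith
  set a := √(1 - α) with ha
  set b := √(1 + α) with hb
  have ha0 : 0 < a := Real.sqrt_pos.mpr h1
  have hb0 : 0 < b := Real.sqrt_pos.mpr h2
  have ha2 : a ^ 2 = 1 - α := Real.sq_sqrt h1.le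
  have hb2 : b ^ 2 = 1 + α := Real.sq_sqrt h2.le
  have hab : a ≤ b := Real.sqrt_le_sqrt (by linarith)
  -- `(1 + q²) (1 + α cos θ) = |1 + q exp (i θ)|²` for this `q`
  set q := (b - a) / (b + a) with hq
  have hq0 : 0 ≤ q := div_nonneg (by linarith) (by linarith)
  have hq1 : q < 1 := by rw [hq, div_lt_one (by linarith)]; linarith
  have hα : α * (1 + q ^ 2) = 2 * q := by
    rw [hq]; field_simp
    linear_combination (2 * α) * (ha2 + hb2) - 2 * (hb2 - ha2)
  have hq2 : 1 + q ^ 2 = (((a + b) / 2) ^ 2)⁻¹ := by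
    have h4 : (b + a) * q = b - a := by rw [hq]; field_simp
    refine eq_inv_of_mul_eq_one_left ?_
    linear_combination (1 / 4) * ((b + a) * q + (b - a)) * h4 + (1 / 2) * (ha2 + hb2)
  have key := integral_one_add_mul_cos_mul_log hq0 hq1 α hα
  have hlogc : Continuous fun φ => Real.log (1 + α * Real.cos (2 * φ)) :=
    Continuous.log (by fun_prop) fun φ => (one_add_mul_cos_pos hα0 hα1 φ).ne'
  have hcc : Continuous fun φ =>
      (1 + α * Real.cos (2 * φ)) * Real.log (1 + α * Real.cos (2 * φ)) :=
    Continuous.mul (by fun_prop) hlogc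
  have e : ∀ φ, weight α φ * (Real.log (halfWidth α φ) - 1 / 2 - Real.log 2)
      = 1 / (2 * π) * ((1 + α * Real.cos (2 * φ)) * Real.log (1 + α * Real.cos (2 * φ)))
        + (-(1 / 2) - Real.log 2) * weight α φ := by
    intro φ
    rw [halfWidth, Real.log_sqrt (one_add_mul_cos_pos hα0 hα1 φ).le, weight]
    field_simp; ring
  simp only [e]
  rw [intervalIntegral.integral_add ((hcc.intervalIntegrable _ _).const_mul _)
      ((continuous_weight.intervalIntegrable _ _).const_mul _),
    intervalIntegral.integral_const_mul, intervalIntegral.integral_const_mul, key,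
    integral_weight, hq2, Real.log_inv, Real.log_pow, ellipseConst, ← ha, ← hb]
  have e3 : a / (a + b) = (1 - q) / 2 := by rw [hq]; field_simp; ring
  rw [e3]
  field_simp
  push_cast
  ring

/-- The weight of a direction and the squared half-width of the ellipse are proportional, so the
quadratic term is the same in all directions. -/
lemma weight_mul_height_sq (hα0 : 0 ≤ α) (hα1 : α < 1) (φ s : ℝ) :
    weight α φ * (Real.log (halfWidth α φ) + s ^ 2 / halfWidth α φ ^ 2 - 1 / 2 - Real.log 2)
      = weight α φ * (Real.log (halfWidth α φ) - 1 / 2 - Real.log 2) + s ^ 2 / π := by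
  have h := one_add_mul_cos_pos hα0 hα1 φ
  have hp := Real.pi_pos
  rw [halfWidth_sq hα0 hα1, weight]
  field_simp
  ring

lemma integral_weight_mul_add_height_sq (hα0 : 0 ≤ α) (hα1 : α < 1) (x : Plane) :
    IntervalIntegrable (fun φ => weight α φ * (Real.log (halfWidth α φ) - 1 / 2 - Real.log 2)
      + height φ x ^ 2 / π) volume 0 π ∧
    ∫ φ in 0..π, (weight α φ * (Real.log (halfWidth α φ) - 1 / 2 - Real.log 2)
      + height φ x ^ 2 / π) = α / 2 - Real.log 2 - ellipseConst α + ‖x‖ ^ 2 / 2 := by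
  have i1 : IntervalIntegrable
      (fun φ => weight α φ * (Real.log (halfWidth α φ) - 1 / 2 - Real.log 2)) volume 0 π :=
    (continuous_weight.mul (((continuous_halfWidth.log
      fun φ => (halfWidth_pos hα0 hα1 φ).ne').sub continuous_const).sub
        continuous_const)).intervalIntegrable _ _
  have i2 : IntervalIntegrable (fun φ => height φ x ^ 2 / π) volume 0 π :=
    Continuous.intervalIntegrable (by unfold height; fun_prop) _ _
  refine ⟨i1.add i2, ?_⟩
  rw [intervalIntegral.integral_add i1 i2, integral_weight_mul_log_halfWidth hα0 hα1,
    integral_height_sq]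

lemma ellipseConst_le_integral_realW_sub (hα0 : 0 ≤ α) (hα1 : α < 1) (x : Plane) :
    ellipseConst α ≤ ∫ y, realW α (x - y) ∂(ellipseLaw α) + ‖x‖ ^ 2 / 2 := by
  obtain ⟨hi, h⟩ := integral_weight_mul_add_height_sq hα0 hα1 x
  have hm := intervalIntegral.integral_mono_on Real.pi_pos.le
    (intervalIntegrable_weight_mul_integral_log hα0 hα1 x) hi fun φ _ => by
      rw [← weight_mul_height_sq hα0 hα1]
      exact mul_le_mul_of_nonneg_left (integral_log_sub_height_le hα0 hα1 φ (height φ x))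
        (weight_pos hα0 hα1 φ).le
  rw [integral_realW_sub hα0 hα1]
  linarith

lemma integral_realW_sub_of_mem_ellipse (hα0 : 0 ≤ α) (hα1 : α < 1) {x : Plane}
    (hx : x ∈ ellipse α) :
    ∫ y, realW α (x - y) ∂(ellipseLaw α) + ‖x‖ ^ 2 / 2 = ellipseConst α := by
  obtain ⟨-, h⟩ := integral_weight_mul_add_height_sq hα0 hα1 x
  rw [integral_realW_sub hα0 hα1]
  have e : ∀ φ, weight α φ * ∫ y, Real.log (height φ x - height φ y) ∂(ellipseLaw α)
      = weight α φ * (Real.log (halfWidth α φ) - 1 / 2 - Real.log 2) + height φ x ^ 2 / π := by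
    intro φ
    rw [← weight_mul_height_sq hα0 hα1,
      integral_log_sub_height_eq hα0 hα1 (abs_height_le_halfWidth hα0 hα1 hx φ)]
  simp only [e]
  rw [h]
  ring

end

/-! ### Positive definiteness of the interaction -/

/-- The mutual interaction energy `∬ W_α(x - y) dν(x) dμ(y)`. -/
noncomputable def interaction (α : ℝ) (ν μ : Measure Plane) : ℝ :=
  ∫ z, realW α (z.1 - z.2) ∂(ν.prod μ)

/-- The mutual interaction energy of `ν` and `μ` is finite. The diagonal, where `W_α` is infinite
and `realW` is not, has to be a null set. -/
structure FiniteInteraction (α : ℝ) (ν μ : Measure Plane) : Prop where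
  ae_ne : ∀ᵐ z ∂(ν.prod μ), z.1 - z.2 ≠ 0
  integrable : Integrable (fun z => realW α (z.1 - z.2)) (ν.prod μ)

/-- The directions `φ ∈ (0, π]` and the scales `t > 0` over which the Gaussian kernels
`exp (-t (height φ x)²)` are superposed. -/
noncomputable def waveMeasure : Measure (ℝ × ℝ) :=
  (volume.restrict (Ioc 0 π)).prod (volume.restrict (Ioi 0))

instance : SFinite waveMeasure := by unfold waveMeasure; infer_instance

/-- The integrand, at `(φ, t)`, of the decomposition of `W_α` into Gaussian plane waves. -/
noncomputable def waveKernel (α : ℝ) (x : Plane) (p : ℝ × ℝ) : ℝ :=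
  weight α p.1 * logKernel (height p.1 x) p.2

variable {α : ℝ}

lemma integrable_waveKernel (hα0 : 0 ≤ α) (hα1 : α < 1) {x : Plane} (hx : x ≠ 0) :
    Integrable (waveKernel α x) waveMeasure := by
  have hm : Measurable (waveKernel α x) := by
    unfold waveKernel weight logKernel height
    fun_prop
  have hne := ae_restrict_of_ae (s := Ioc 0 π) (ae_height_ne_zero hx)
  rw [waveMeasure, integrable_prod_iff hm.aestronglyMeasurable]
  constructor
  · filter_upwards [hne] with φ hφ
    exact (integrableOn_logKernel hφ).const_mul (weight α φ)
  · have hi : IntervalIntegrable (fun φ => |Real.log (height φ x)| * weight α φ) volume 0 π :=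
      (intervalIntegrable_log_height x 0 π).abs.mul_continuousOn
        continuous_weight.continuousOn
    rw [intervalIntegrable_iff_integrableOn_Ioc_of_le Real.pi_pos.le] at hi
    refine Integrable.congr hi ?_
    filter_upwards [hne] with φ hφ
    simp only [waveKernel, norm_mul, Real.norm_eq_abs, abs_of_pos (weight_pos hα0 hα1 φ)]
    rw [integral_const_mul, integral_abs_logKernel hφ, mul_comm]

lemma integral_waveKernel (hα0 : 0 ≤ α) (hα1 : α < 1) {x : Plane} (hx : x ≠ 0) :
    ∫ p, waveKernel α x p ∂waveMeasure = realW α x - (α / 2 - Real.log 2) := by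
  have hne := ae_restrict_of_ae (s := Ioc 0 π) (ae_height_ne_zero hx)
  have hi := integrable_waveKernel hα0 hα1 hx
  rw [waveMeasure] at hi ⊢
  rw [integral_prod _ hi, realW_eq_integral hx,
    intervalIntegral.integral_of_le Real.pi_pos.le, sub_sub_cancel_left, ← integral_neg]
  refine integral_congr_ae ?_
  filter_upwards [hne] with φ hφ
  simp only [waveKernel]
  rw [integral_const_mul, integral_logKernel hφ, mul_neg]

lemma abs_log_norm_le (hα0 : 0 ≤ α) (x : Plane) :
    |Real.log ‖x‖| ≤ |realW α x| + α := by
  have h1 : 0 ≤ x 0 ^ 2 / (x 0 ^ 2 + x 1 ^ 2) := by positivity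
  have h2 : x 0 ^ 2 / (x 0 ^ 2 + x 1 ^ 2) ≤ 1 :=
    div_le_one_of_le₀ (by nlinarith [sq_nonneg (x 1)]) (by positivity)
  have e : Real.log ‖x‖ = -(realW α x) + α * (x 0 ^ 2 / (x 0 ^ 2 + x 1 ^ 2)) := by
    rw [realW, ← norm_sq_eq_add_sq, Real.log_pow]; push_cast; ring
  rw [e]
  refine (abs_add_le _ _).trans ?_
  rw [abs_neg, abs_of_nonneg (mul_nonneg hα0 h1)]
  nlinarith

lemma integral_norm_waveKernel_le (hα0 : 0 ≤ α) (hα1 : α < 1) {x : Plane} (hx : x ≠ 0) :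
    ∫ p, ‖waveKernel α x p‖ ∂waveMeasure ≤ 2 / π * (π * (|realW α x| + α)
      + ∫ φ in 0..π, |Real.log (Real.sin φ)|) := by
  have hp := Real.pi_pos
  have hne := ae_restrict_of_ae (s := Ioc 0 π) (ae_height_ne_zero hx)
  have hi := (integrable_waveKernel hα0 hα1 hx).norm
  have hI : IntegrableOn (fun φ => 2 / π * |Real.log (height φ x)|) (Ioc 0 π) := by
    have h := (intervalIntegrable_log_height x 0 π).abs.const_mul (2 / π)
    rwa [intervalIntegrable_iff_integrableOn_Ioc_of_le hp.le] at h
  have h1 : ∫ p, ‖waveKernel α x p‖ ∂waveMeasure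
      ≤ ∫ φ in Ioc 0 π, 2 / π * |Real.log (height φ x)| := by
    rw [waveMeasure] at hi ⊢
    rw [integral_prod _ hi]
    refine integral_mono_ae hi.integral_prod_left hI ?_
    filter_upwards [hne] with φ hφ
    simp only [waveKernel, norm_mul, Real.norm_eq_abs, abs_of_pos (weight_pos hα0 hα1 φ)]
    rw [integral_const_mul, integral_abs_logKernel hφ]
    refine mul_le_mul_of_nonneg_right ?_ (abs_nonneg _)
    rw [weight]
    gcongr
    nlinarith [Real.cos_le_one (2 * φ)]
  rw [integral_const_mul, ← intervalIntegral.integral_of_le hp.le] at h1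
  refine h1.trans (mul_le_mul_of_nonneg_left ?_ (by positivity))
  have h2 := integral_abs_log_height_le hx
  have h3 := mul_le_mul_of_nonneg_left (abs_log_norm_le hα0 x) hp.le
  linarith

section

variable {ν μ : Measure Plane} [IsProbabilityMeasure ν] [IsProbabilityMeasure μ]

lemma FiniteInteraction.integrable_waveKernel (h : FiniteInteraction α ν μ) (hα0 : 0 ≤ α)
    (hα1 : α < 1) :
    Integrable (fun w : (Plane × Plane) × (ℝ × ℝ) => waveKernel α (w.1.1 - w.1.2) w.2)
      ((ν.prod μ).prod waveMeasure) := by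
  have hm : Measurable fun w : (Plane × Plane) × (ℝ × ℝ) =>
      waveKernel α (w.1.1 - w.1.2) w.2 := by
    unfold waveKernel weight logKernel height
    fun_prop
  rw [integrable_prod_iff hm.aestronglyMeasurable]
  constructor
  · filter_upwards [h.ae_ne] with z hz
    exact EllipseLaw.integrable_waveKernel hα0 hα1 hz
  · have hi : Integrable (fun z : Plane × Plane => 2 / π * (π * (|realW α (z.1 - z.2)| + α)
        + ∫ φ in 0..π, |Real.log (Real.sin φ)|)) (ν.prod μ) :=
      (((h.integrable.abs.add (integrable_const α)).const_mul π).add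
        (integrable_const _)).const_mul (2 / π)
    refine hi.mono' hm.norm.stronglyMeasurable.integral_prod_right'.aestronglyMeasurable ?_
    filter_upwards [h.ae_ne] with z hz
    rw [Real.norm_eq_abs, abs_of_nonneg (integral_nonneg fun y => norm_nonneg _)]
    exact integral_norm_waveKernel_le hα0 hα1 hz

lemma integral_waveKernel_prod {φ t : ℝ} (ht : 0 < t) :
    ∫ z, waveKernel α (z.1 - z.2) (φ, t) ∂(ν.prod μ) = weight α φ / (2 * t)
      * (gaussEnergy t (ν.map (height φ)) (μ.map (height φ)) - Real.exp (-t)) := by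
  have hh := (continuous_height φ).measurable
  have e : gaussEnergy t (ν.map (height φ)) (μ.map (height φ))
      = ∫ z, Real.exp (-(t * (height φ (z.1 - z.2)) ^ 2)) ∂(ν.prod μ) := by
    rw [gaussEnergy, Measure.map_prod_map _ _ hh hh,
      integral_map (hh.prodMap hh).aemeasurable (by fun_prop)]
    simp only [Prod.map_fst, Prod.map_snd, height_sub]
  have hi : Integrable (fun z : Plane × Plane => Real.exp (-(t * (height φ (z.1 - z.2)) ^ 2)))
      (ν.prod μ) := by
    refine Integrable.of_bound (C := 1) (Continuous.aestronglyMeasurable ?_)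
      (ae_of_all _ fun z => ?_)
    · have := continuous_height φ
      fun_prop
    · rw [Real.norm_eq_abs, abs_of_pos (Real.exp_pos _), Real.exp_le_one_iff]
      have : 0 ≤ t * height φ (z.1 - z.2) ^ 2 := by positivity
      linarith
  rw [e]
  simp only [waveKernel, logKernel, mul_div_assoc']
  rw [integral_div, integral_const_mul, integral_sub hi (integrable_const _)]
  simp
  ring

lemma FiniteInteraction.interaction_eq (h : FiniteInteraction α ν μ) (hα0 : 0 ≤ α)
    (hα1 : α < 1) : interaction α ν μ = α / 2 - Real.log 2
      + ∫ p, ∫ z, waveKernel α (z.1 - z.2) p ∂(ν.prod μ) ∂waveMeasure := by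
  rw [← integral_integral_swap (h.integrable_waveKernel hα0 hα1)]
  have h1 : ∫ z : Plane × Plane, ∫ p, waveKernel α (z.1 - z.2) p ∂waveMeasure ∂(ν.prod μ)
      = ∫ z : Plane × Plane, (realW α (z.1 - z.2) - (α / 2 - Real.log 2)) ∂(ν.prod μ) := by
    refine integral_congr_ae ?_
    filter_upwards [h.ae_ne] with z hz
    exact integral_waveKernel hα0 hα1 hz
  rw [h1, integral_sub h.integrable (integrable_const _), interaction]
  simp

lemma ae_waveMeasure_pos : ∀ᵐ p ∂waveMeasure, 0 < p.2 := by
  have h : MeasurableSet {p : ℝ × ℝ | 0 < p.2} := measurableSet_lt (by fun_prop) (by fun_prop)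
  rw [waveMeasure, Measure.ae_prod_iff_ae_ae h]
  exact ae_of_all _ fun _ => ae_restrict_mem measurableSet_Ioi

/-- The interaction energy of the neutral charge `ν - μ` is nonnegative, and it vanishes only if
`ν = μ`: every Gaussian plane wave contributes a nonnegative amount. -/
theorem interaction_sub (hα0 : 0 ≤ α) (hα1 : α < 1) (hν : FiniteInteraction α ν ν)
    (hμ : FiniteInteraction α μ μ) (h : FiniteInteraction α ν μ) :
    0 ≤ interaction α ν ν + interaction α μ μ - 2 * interaction α ν μ ∧
    (interaction α ν ν + interaction α μ μ - 2 * interaction α ν μ = 0 → ν = μ) := by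
  have prob : ∀ (η : Measure Plane) [IsProbabilityMeasure η] (φ : ℝ),
      IsProbabilityMeasure (η.map (height φ)) := fun η _ φ =>
    Measure.isProbabilityMeasure_map (continuous_height φ).aemeasurable
  set D : ℝ × ℝ → ℝ := fun p => ∫ z, waveKernel α (z.1 - z.2) p ∂(ν.prod ν)
    + ∫ z, waveKernel α (z.1 - z.2) p ∂(μ.prod μ)
    - 2 * ∫ z, waveKernel α (z.1 - z.2) p ∂(ν.prod μ) with hD
  have i1 := (hν.integrable_waveKernel hα0 hα1).integral_prod_right
  have i2 := (hμ.integrable_waveKernel hα0 hα1).integral_prod_right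
  have i3 := (h.integrable_waveKernel hα0 hα1).integral_prod_right
  have hDi : Integrable D waveMeasure := (i1.add i2).sub (i3.const_mul 2)
  have hDe : interaction α ν ν + interaction α μ μ - 2 * interaction α ν μ
      = ∫ p, D p ∂waveMeasure := by
    rw [hν.interaction_eq hα0 hα1, hμ.interaction_eq hα0 hα1, h.interaction_eq hα0 hα1, hD,
      integral_sub (by exact i1.add i2) (i3.const_mul 2), integral_add i1 i2, integral_const_mul]
    ring
  have hDp : ∀ φ t : ℝ, 0 < t → D (φ, t) = weight α φ / (2 * t)
      * (gaussEnergy t (ν.map (height φ)) (ν.map (height φ))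
        + gaussEnergy t (μ.map (height φ)) (μ.map (height φ))
        - 2 * gaussEnergy t (ν.map (height φ)) (μ.map (height φ))) := by
    intro φ t ht
    simp only [hD, integral_waveKernel_prod ht]
    ring
  have hD0 : 0 ≤ᵐ[waveMeasure] D := by
    filter_upwards [ae_waveMeasure_pos] with p hp
    have := prob ν p.1
    have := prob μ p.1
    rw [← Prod.mk.eta (p := p), hDp _ _ hp]
    have := weight_pos hα0 hα1 p.1
    exact mul_nonneg (by positivity) (gaussEnergy_sub_nonneg hp.le _ _)
  rw [hDe]
  refine ⟨integral_nonneg_of_ae hD0, fun h0 => ?_⟩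
  rw [integral_eq_zero_iff_of_nonneg_ae hD0 hDi] at h0
  refine eq_of_ae_map_height_eq ?_
  have h1 := Measure.ae_ae_of_ae_prod (μ := volume.restrict (Ioc 0 π))
    (ν := volume.restrict (Ioi 0)) (h0.and ae_waveMeasure_pos)
  filter_upwards [h1] with φ hφ
  have hne : (ae (volume.restrict (Ioi (0 : ℝ)))).NeBot := by
    rw [ae_neBot, Ne, Measure.restrict_eq_zero]; simp
  obtain ⟨t, ht0, ht⟩ := hφ.exists
  have := prob ν φ
  have := prob μ φ
  rw [hDp φ t ht] at ht0
  have hw := weight_pos hα0 hα1 φ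
  have ht2 : 0 < t := ht
  refine eq_of_gaussEnergy_sub_eq_zero ht2 _ _ ((mul_eq_zero.mp ht0).resolve_left ?_)
  positivity

end

/-! ### Energies of probability measures -/

lemma toENNReal_coe (r : ℝ) : (r : EReal).toENNReal = ENNReal.ofReal r := by
  rw [EReal.toENNReal_of_ne_top (EReal.coe_ne_top _), EReal.toReal_coe]

lemma extIntegral_eq_of_ae_eq {X : Type*} [MeasurableSpace X] {μ : Measure X} {f : X → EReal}
    {g : X → ℝ} (hfg : ∀ᵐ x ∂μ, f x = (g x : EReal)) (hg : Integrable g μ) :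
    extIntegral μ f = ((∫ x, g x ∂μ : ℝ) : EReal) := by
  have h1 : ∫⁻ x, (f x).toENNReal ∂μ = ∫⁻ x, ENNReal.ofReal (g x) ∂μ :=
    lintegral_congr_ae (hfg.mono fun x hx => by simp only [hx, toENNReal_coe])
  have h2 : ∫⁻ x, (-f x).toENNReal ∂μ = ∫⁻ x, ENNReal.ofReal (-g x) ∂μ :=
    lintegral_congr_ae (hfg.mono fun x hx => by
      simp only [hx, ← EReal.coe_neg, toENNReal_coe])
  have h3 := hg.lintegral_lt_top
  have h4 := hg.neg.lintegral_lt_top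
  simp only [Pi.neg_apply] at h4
  rw [extIntegral, h1, h2, integral_eq_lintegral_pos_part_sub_lintegral_neg_part hg,
    EReal.coe_sub]
  generalize ∫⁻ x, ENNReal.ofReal (g x) ∂μ = P at *
  generalize ∫⁻ x, ENNReal.ofReal (-g x) ∂μ = N at *
  lift P to NNReal using h3.ne
  lift N to NNReal using h4.ne
  rfl

section

variable {α : ℝ} {ν : Measure Plane} [IsProbabilityMeasure ν]

lemma integrable_half_norm_sq_add (h2 : Integrable (fun x => ‖x‖ ^ 2) ν) :
    Integrable (fun z : Plane × Plane => (‖z.1‖ ^ 2 + ‖z.2‖ ^ 2) / 2) (ν.prod ν) ∧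
    ∫ z : Plane × Plane, (‖z.1‖ ^ 2 + ‖z.2‖ ^ 2) / 2 ∂(ν.prod ν) = ∫ x, ‖x‖ ^ 2 ∂ν := by
  have i1 : Integrable (fun z : Plane × Plane => ‖z.1‖ ^ 2) (ν.prod ν) := h2.comp_fst ν
  have i2 : Integrable (fun z : Plane × Plane => ‖z.2‖ ^ 2) (ν.prod ν) := h2.comp_snd ν
  refine ⟨(i1.add i2).div_const 2, ?_⟩
  rw [integral_div, integral_add i1 i2, integral_fun_fst (fun x : Plane => ‖x‖ ^ 2),
    integral_fun_snd (fun x : Plane => ‖x‖ ^ 2)]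
  simp

lemma energy_eq_coe (h : FiniteInteraction α ν ν) (h2 : Integrable (fun x => ‖x‖ ^ 2) ν) :
    energy α ν = ((1 / 2 * (interaction α ν ν + ∫ x, ‖x‖ ^ 2 ∂ν) : ℝ) : EReal) := by
  obtain ⟨hb, hbe⟩ := integrable_half_norm_sq_add h2
  rw [energy, extIntegral_eq_of_ae_eq (g := fun z : Plane × Plane =>
    realW α (z.1 - z.2) + (‖z.1‖ ^ 2 + ‖z.2‖ ^ 2) / 2) ?_ (h.integrable.add hb),
    integral_add h.integrable hb, hbe, ← EReal.coe_mul]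
  · rfl
  · filter_upwards [h.ae_ne] with z hz
    rw [W_eq_realW hz, EReal.coe_add]

/-- A lower bound for the interaction by a fraction of the confinement. -/
lemma neg_le_realW (hα0 : 0 ≤ α) {x y : Plane} (h : x - y ≠ 0) :
    -((‖x‖ ^ 2 + ‖y‖ ^ 2) / 2 / 2) - Real.log 8 ≤ realW α (x - y) := by
  set z := x - y with hz
  have hr : 0 < ‖z‖ := norm_pos_iff.mpr h
  have h1 : 0 ≤ α * (z 0 ^ 2 / (z 0 ^ 2 + z 1 ^ 2)) := by positivity
  have h2 : ‖z‖ ≤ ‖x‖ + ‖y‖ := norm_sub_le x y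
  have h3 : ‖z‖ ^ 2 ≤ 2 * (‖x‖ ^ 2 + ‖y‖ ^ 2) := by
    nlinarith [sq_nonneg (‖x‖ - ‖y‖), norm_nonneg x, norm_nonneg y]
  have h4 := Real.log_le_sub_one_of_pos (show 0 < ‖z‖ ^ 2 / 8 by positivity)
  rw [Real.log_div (by positivity) (by norm_num)] at h4
  have h5 : 0 ≤ Real.log 8 := Real.log_nonneg (by norm_num)
  have h6 : -(1 / 2) * Real.log (‖z‖ ^ 2) ≤ realW α z := by
    rw [realW, ← norm_sq_eq_add_sq] at *
    exact le_add_of_nonneg_right h1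
  linarith [sq_nonneg ‖x‖, sq_nonneg ‖y‖]

/-- Measures of finite energy do not charge the diagonal, and their interaction and confinement
energies are finite separately. -/
lemma finiteInteraction_of_energy_ne_top (hα0 : 0 ≤ α) (hE : energy α ν ≠ ⊤) :
    FiniteInteraction α ν ν ∧ Integrable (fun x => ‖x‖ ^ 2) ν := by
  set f : Plane × Plane → EReal := fun p =>
    W α (p.1 - p.2) + (((‖p.1‖ ^ 2 + ‖p.2‖ ^ 2) / 2 : ℝ) : EReal) with hf
  have hfm : Measurable f :=
    ((measurable_W α).comp (measurable_fst.sub measurable_snd)).add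
      (measurable_coe_real_ereal.comp (by fun_prop))
  have hpos : ∫⁻ p, (f p).toENNReal ∂(ν.prod ν) ≠ ⊤ := by
    intro htop
    have hneg : ∀ p, (-(f p)).toENNReal = 0 := by
      intro p
      apply EReal.toENNReal_of_nonpos
      have h := neg_le_W hα0 p.1 p.2
      have h' : (0 : EReal) ≤ f p := by
        have h2 := add_le_add_left h (((‖p.1‖ ^ 2 + ‖p.2‖ ^ 2) / 2 : ℝ) : EReal)
        rw [← EReal.coe_add, neg_add_cancel] at h2
        exact h2
      rw [EReal.neg_le]; simpa using h'
    apply hE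
    change ((1 / 2 : ℝ) : EReal) * extIntegral (ν.prod ν) f = ⊤
    rw [extIntegral, htop]
    simp only [hneg, lintegral_zero]
    simp only [EReal.coe_ennreal_top, EReal.coe_ennreal_zero, sub_zero]
    exact EReal.coe_mul_top_of_pos (by norm_num)
  have hne : ∀ᵐ z ∂(ν.prod ν), z.1 - z.2 ≠ 0 := by
    filter_upwards [ae_lt_top hfm.ereal_toENNReal hpos] with z hz h0
    rw [hf] at hz
    simp only [h0, W, if_true, EReal.top_add_coe, EReal.toENNReal_top, lt_self_iff_false] at hz
  set k : Plane × Plane → ℝ := fun z =>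
    realW α (z.1 - z.2) + (‖z.1‖ ^ 2 + ‖z.2‖ ^ 2) / 2 with hk
  have hfk : ∀ᵐ z ∂(ν.prod ν), f z = (k z : EReal) := by
    filter_upwards [hne] with z hz
    rw [hf, hk]
    simp only
    rw [W_eq_realW hz, EReal.coe_add]
  have hkm : Measurable k := ((measurable_realW α).comp
    (measurable_fst.sub measurable_snd)).add (by fun_prop)
  have hk0 : ∀ᵐ z ∂(ν.prod ν), 0 ≤ k z := by
    filter_upwards [hfk, hne] with z hz hz0
    have h := neg_le_W hα0 z.1 z.2
    rw [W_eq_realW hz0] at h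
    have h' : -((‖z.1‖ ^ 2 + ‖z.2‖ ^ 2) / 2) ≤ realW α (z.1 - z.2) := by exact_mod_cast h
    simp only [hk]
    linarith
  have hki : Integrable k (ν.prod ν) := by
    rw [← lintegral_ofReal_ne_top_iff_integrable hkm.aestronglyMeasurable hk0,
      ← lintegral_congr_ae (f := fun z => (f z).toENNReal)
        (hfk.mono fun z hz => by simp only [hz, toENNReal_coe])]
    exact hpos
  have hb : Integrable (fun z : Plane × Plane => (‖z.1‖ ^ 2 + ‖z.2‖ ^ 2) / 2) (ν.prod ν) := by
    refine ((hki.add (integrable_const (Real.log 8))).const_mul 2).mono'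
      (by fun_prop) ?_
    filter_upwards [hne] with z hz
    have h := neg_le_realW hα0 hz
    rw [Real.norm_eq_abs, abs_of_nonneg (by positivity)]
    simp only [hk, Pi.add_apply]
    linarith
  refine ⟨⟨hne, ?_⟩, ?_⟩
  · refine (hki.sub hb).congr (ae_of_all _ fun z => ?_)
    simp [hk]
  · have h1 : Integrable ((fun x : Plane => ‖x‖ ^ 2) ∘ Prod.fst) (ν.prod ν) := by
      refine (hb.const_mul 2).mono' (by fun_prop) (ae_of_all _ fun z => ?_)
      simp only [Function.comp_apply]
      rw [Real.norm_eq_abs, abs_of_nonneg (by positivity)]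
      nlinarith [sq_nonneg ‖z.2‖]
    exact (measurePreserving_fst.integrable_comp (by fun_prop)).mp h1

lemma integrable_norm_sq_ellipseLaw (hα0 : 0 ≤ α) (hα1 : α < 1) :
    Integrable (fun x => ‖x‖ ^ 2) (ellipseLaw α) := by
  have := isProbabilityMeasure_ellipseLaw hα0 hα1
  refine Integrable.of_bound (C := 2 ^ 2 + 2 ^ 2) (by fun_prop) ?_
  filter_upwards [ae_mem_ellipse α] with x hx
  have h0 := (abs_height_le_halfWidth hα0 hα1 hx (π / 2)).trans (halfWidth_le_two hα0 hα1 _)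
  have h1 := (abs_height_le_halfWidth hα0 hα1 hx 0).trans (halfWidth_le_two hα0 hα1 _)
  simp only [height, Real.cos_pi_div_two, Real.sin_pi_div_two, Real.cos_zero, Real.sin_zero,
    mul_zero, mul_one, zero_sub, sub_zero, abs_neg] at h0 h1
  rw [Real.norm_eq_abs, abs_of_nonneg (by positivity), norm_sq_eq_add_sq]
  exact add_le_add (sq_le_sq.mpr (by simpa using h0)) (sq_le_sq.mpr (by simpa using h1))

lemma finiteInteraction_ellipseLaw (hα0 : 0 ≤ α) (hα1 : α < 1)
    (h2 : Integrable (fun x => ‖x‖ ^ 2) ν) : FiniteInteraction α ν (ellipseLaw α) := by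
  have := isProbabilityMeasure_ellipseLaw hα0 hα1
  have hm : Measurable fun z : Plane × Plane => realW α (z.1 - z.2) :=
    (measurable_realW α).comp (measurable_fst.sub measurable_snd)
  refine ⟨?_, ?_⟩
  · rw [Measure.ae_prod_iff_ae_ae]
    · exact ae_of_all _ fun x => ae_ne_ellipseLaw α x
    · exact (measurableSet_eq_fun (by fun_prop) (by fun_prop)).compl
  · rw [integrable_prod_iff hm.aestronglyMeasurable]
    refine ⟨ae_of_all _ fun x => integrable_realW_sub hα0 hα1 x, ?_⟩
    have hn : Integrable (fun x => ‖x‖) ν := by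
      refine ((integrable_const (1 : ℝ)).add h2).mono' (by fun_prop) (ae_of_all _ fun x => ?_)
      simp only [norm_norm, Pi.add_apply]
      nlinarith [sq_nonneg (‖x‖ - 1)]
    have hB : Integrable (fun x => |α / 2 - Real.log 2| + logBound α x) ν := by
      unfold logBound
      exact (integrable_const _).add
        (((hn.add (integrable_const 2)).const_mul 2).sub (integrable_const _))
    refine hB.mono' hm.norm.stronglyMeasurable.integral_prod_right'.aestronglyMeasurable
      (ae_of_all _ fun x => ?_)
    rw [Real.norm_eq_abs, abs_of_nonneg (integral_nonneg fun y => norm_nonneg _)]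
    exact integral_abs_realW_sub_le hα0 hα1 x

lemma interaction_ellipseLaw_eq (hα0 : 0 ≤ α) (hα1 : α < 1)
    (h2 : Integrable (fun x => ‖x‖ ^ 2) ν) :
    Integrable (fun x => ∫ y, realW α (x - y) ∂(ellipseLaw α) + ‖x‖ ^ 2 / 2) ν ∧
    interaction α ν (ellipseLaw α) + (∫ x, ‖x‖ ^ 2 ∂ν) / 2
      = ∫ x, (∫ y, realW α (x - y) ∂(ellipseLaw α) + ‖x‖ ^ 2 / 2) ∂ν := by
  have := isProbabilityMeasure_ellipseLaw hα0 hα1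
  have hi := (finiteInteraction_ellipseLaw hα0 hα1 h2).integrable
  refine ⟨hi.integral_prod_left.add (h2.div_const 2), ?_⟩
  rw [integral_add hi.integral_prod_left (h2.div_const 2), integral_div, interaction,
    integral_prod _ hi]

lemma ellipseConst_le_interaction (hα0 : 0 ≤ α) (hα1 : α < 1)
    (h2 : Integrable (fun x => ‖x‖ ^ 2) ν) :
    ellipseConst α ≤ interaction α ν (ellipseLaw α) + (∫ x, ‖x‖ ^ 2 ∂ν) / 2 := by
  obtain ⟨hi, he⟩ := interaction_ellipseLaw_eq hα0 hα1 h2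
  rw [he]
  calc ellipseConst α = ∫ _, ellipseConst α ∂ν := by simp
    _ ≤ _ := integral_mono (integrable_const _) hi
      fun x => ellipseConst_le_integral_realW_sub hα0 hα1 x

lemma interaction_self_ellipseLaw (hα0 : 0 ≤ α) (hα1 : α < 1) :
    interaction α (ellipseLaw α) (ellipseLaw α) + (∫ x, ‖x‖ ^ 2 ∂(ellipseLaw α)) / 2
      = ellipseConst α := by
  have := isProbabilityMeasure_ellipseLaw hα0 hα1
  rw [(interaction_ellipseLaw_eq hα0 hα1 (integrable_norm_sq_ellipseLaw hα0 hα1)).2]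
  calc _ = ∫ _, ellipseConst α ∂(ellipseLaw α) := by
        refine integral_congr_ae ?_
        filter_upwards [ae_mem_ellipse α] with x hx
        exact integral_realW_sub_of_mem_ellipse hα0 hα1 hx
    _ = _ := by simp

lemma energy_ellipseLaw (hα0 : 0 ≤ α) (hα1 : α < 1) :
    energy α (ellipseLaw α) = ((1 / 2 * (interaction α (ellipseLaw α) (ellipseLaw α)
      + ∫ x, ‖x‖ ^ 2 ∂(ellipseLaw α)) : ℝ) : EReal) := by
  have := isProbabilityMeasure_ellipseLaw hα0 hα1
  have h2 := integrable_norm_sq_ellipseLaw hα0 hα1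
  exact energy_eq_coe (finiteInteraction_ellipseLaw hα0 hα1 h2) h2

/-- By the Euler–Lagrange conditions, the energy of `ν` exceeds that of the ellipse law by at
least half the interaction energy of the difference of the two measures. -/
lemma energy_ellipseLaw_le (hα0 : 0 ≤ α) (hα1 : α < 1) (ν : Measure Plane)
    [IsProbabilityMeasure ν] : energy α (ellipseLaw α) ≤ energy α ν ∧
    (energy α ν ≤ energy α (ellipseLaw α) → ν = ellipseLaw α) := by
  have := isProbabilityMeasure_ellipseLaw hα0 hα1
  by_cases hE : energy α ν = ⊤
  · refine ⟨hE ▸ le_top, fun h => ?_⟩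
    rw [hE, energy_ellipseLaw hα0 hα1, top_le_iff] at h
    exact absurd h (EReal.coe_ne_top _)
  · obtain ⟨hν, h2⟩ := finiteInteraction_of_energy_ne_top hα0 hE
    have hμ2 := integrable_norm_sq_ellipseLaw hα0 hα1
    have hμ := finiteInteraction_ellipseLaw hα0 hα1 hμ2
    obtain ⟨hsub, heq⟩ := interaction_sub hα0 hα1 hν hμ
      (finiteInteraction_ellipseLaw hα0 hα1 h2)
    have h3 := ellipseConst_le_interaction hα0 hα1 h2
    have h4 := interaction_self_ellipseLaw hα0 hα1
    rw [energy_ellipseLaw hα0 hα1, energy_eq_coe hν h2, EReal.coe_le_coe_iff,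
      EReal.coe_le_coe_iff]
    exact ⟨by linarith, fun h => heq (by linarith)⟩

lemma potential_ellipseLaw (hα0 : 0 ≤ α) (hα1 : α < 1) (x : Plane) :
    potential α (ellipseLaw α) x = ((∫ y, realW α (x - y) ∂(ellipseLaw α) : ℝ) : EReal) := by
  refine extIntegral_eq_of_ae_eq ?_ (integrable_realW_sub hα0 hα1 x)
  filter_upwards [ae_ne_ellipseLaw α x] with y hy
  exact W_eq_realW hy

lemma secondMoment_ellipseLaw (hα0 : 0 ≤ α) (hα1 : α < 1) :
    secondMoment (ellipseLaw α) = ((∫ x, ‖x‖ ^ 2 ∂(ellipseLaw α) : ℝ) : EReal) :=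
  extIntegral_eq_of_ae_eq (ae_of_all _ fun _ => rfl) (integrable_norm_sq_ellipseLaw hα0 hα1)

end

end EllipseLaw

theorem theorem1p1 (α : ℝ) (hα0 : 0 ≤ α) (hα1 : α < 1) :
    (∀ μ : Measure Plane, IsMinimiser α μ ↔ μ = ellipseLaw α) ∧
    (∀ x : Plane, potential α (ellipseLaw α) x ≠ ⊤) ∧
    (∀ x ∈ ellipse α,
      potential α (ellipseLaw α) x + ((‖x‖ ^ 2 / 2 : ℝ) : EReal) = (ellipseConst α : EReal)) ∧
    (∀ x : Plane,
      (ellipseConst α : EReal) ≤ potential α (ellipseLaw α) x + ((‖x‖ ^ 2 / 2 : ℝ) : EReal)) ∧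
    (ellipseConst α : EReal) =
      ((2 : ℝ) : EReal) * energy α (ellipseLaw α)
        - ((1 / 2 : ℝ) : EReal) * secondMoment (ellipseLaw α) := by
  have hprob := isProbabilityMeasure_ellipseLaw hα0 hα1
  refine ⟨fun μ => ⟨fun ⟨h, hmin⟩ => ?_, ?_⟩, fun x => ?_, fun x hx => ?_, fun x => ?_, ?_⟩
  · exact (energy_ellipseLaw_le hα0 hα1 μ).2 (hmin _ hprob)
  · rintro rfl
    exact ⟨hprob, fun ν _ => (energy_ellipseLaw_le hα0 hα1 ν).1⟩
  · rw [potential_ellipseLaw hα0 hα1]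
    exact EReal.coe_ne_top _
  · rw [potential_ellipseLaw hα0 hα1, ← EReal.coe_add,
      integral_realW_sub_of_mem_ellipse hα0 hα1 hx]
  · rw [potential_ellipseLaw hα0 hα1, ← EReal.coe_add, EReal.coe_le_coe_iff]
    exact ellipseConst_le_integral_realW_sub hα0 hα1 x
  · rw [energy_ellipseLaw hα0 hα1, secondMoment_ellipseLaw hα0 hα1, ← EReal.coe_mul,
      ← EReal.coe_mul, ← EReal.coe_sub, ← interaction_self_ellipseLaw hα0 hα1]
    congr 1
    ring
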